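/- Let $B\subset\mathbb R^2$ be a closed convex set with $B=-B$ and $\operatorname{int}B\neq\emptyset$, and let $\|v\|_B=\inf\{r>0: v\in rB\}$ be the associated seminorm. For a rectifiable curve $\gamma$ let $\operatorname{len}_B(\gamma)=\int_\gamma\|\mathrm dx\|_B$ be its length in this seminorm. For a compact convex set $L\subset\mathbb R^2$ put $\operatorname{per}_B(L)=\operatorname{len}_B(\operatorname{bd}L)$ if $\operatorname{int}L\ne\emptyset$ and $\operatorname{per}_B(L)=2\operatorname{len}_B(L)$ otherwise. Let $K\subset\mathbb R^2$ be a compact convex set with nonempty interior, put $g_{K,\operatorname{per}_B}(y)=\operatorname{per}_B(K\cap(K+y))$ and $DK=\{y-z:y,z\in K\}$, and let $x\in\operatorname{int}(DK)\setminus\{o\}$. For $a,b\in\operatorname{bd}K$ let $[a,b]_{\operatorname{bd}K}$ be the closed arc of $\operatorname{bd}K$ from $a$ to $b$ in counterclockwise order. The right (left) tangent of $K$ at $p\in\operatorname{bd}K$ is the line tangent at $p$ to the portion of $\operatorname{bd}K$ that follows (precedes) $p$ in counterclockwise order. Let $p_1,p_2,p_3,p_4\in\operatorname{bd}K$ be the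 vertices, in counterclockwise order, of a nondegenerate parallelogram $\operatorname{ip}(x)$ such that $x=p_1-p_2=p_4-p_3$. If $[p_1,p_2]_{\operatorname{bd}K}$ is not the segment $[p_1,p_2]$, let $p_{1,2}$ be an intersection point of the right tangent of $K$ at $p_1$ and the left tangent of $K$ at $p_2$; otherwise let $p_{1,2}$ be any point of $[p_1,p_2]$. Let $p_{3,4}$ be defined in the same way from $p_3,p_4$. Put $$\operatorname{cap}(K,x)=[p_1,p_{1,2}]\cup[p_{1,2},p_2],\qquad \operatorname{cap}(K,-x)=[p_3,p_{3,4}]\cup[p_{3,4},p_4].$$ Then such points $p_1,\dots,p_4,p_{1,2},p_{3,4}$ exist and, for every choice of them, the left derivative of $t\mapsto g_{K,\operatorname{per}_B}(tx)$ at $t=1$ exists and $$-\left.\frac{\partial^-}{\partial t}g_{K,\operatorname{per}_B}(tx)\right|_{t=1}=\operatorname{len}_B(\operatorname{cap}(K,x))+\operatorname{len}_B(\operatorname{cap}(K,-x)).$$ -/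

import Mathlib

open Set Filter Topology
open scoped Pointwise ENNReal

noncomputable section

/-- The Euclidean plane. -/
abbrev Plane : Type := EuclideanSpace ℝ (Fin 2)

/-- The determinant of the matrix with columns `u`, `v`; it is positive exactly when `v` is obtained
from a positive multiple of `u` by a counterclockwise rotation by an angle in `(0, π)` and a scaling. -/
def det2 (u v : Plane) : ℝ := u 0 * v 1 - u 1 * v 0

/-- A planar convex body: a compact convex subset of the plane with nonempty interior. -/
structure IsPlanarBody (K : Set Plane) : Prop where
  isCompact : IsCompact K
  convex : Convex ℝ K
  interior_nonempty : (interior K).Nonempty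

/-- A closed convex `o`-symmetric set with nonempty interior (possibly unbounded). The associated
seminorm is its Minkowski functional `gauge B`, `gauge B v = inf {r > 0 | v ∈ r • B}`. -/
structure IsSeminormBall (B : Set Plane) : Prop where
  isClosed : IsClosed B
  convex : Convex ℝ B
  symm : -B = B
  interior_nonempty : (interior B).Nonempty

/-! ### Length and perimeter in the seminorm with unit ball `B` -/

/-- The length of the path `γ : [0,1] → ℝ²` in the seminorm `gauge B`: the supremum of the sums
`∑ i, ‖γ (u (i+1)) - γ (u i)‖_B` over all `0 ≤ u 0 ≤ u 1 ≤ ⋯ ≤ u n ≤ 1`. -/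
def pathLen (B : Set Plane) (γ : ℝ → Plane) : ℝ≥0∞ :=
  ⨆ p : ℕ × {u : ℕ → ℝ // Monotone u ∧ ∀ i, u i ∈ Icc (0 : ℝ) 1},
    ∑ i ∈ Finset.range p.1, ENNReal.ofReal (gauge B (γ (p.2.1 (i + 1)) - γ (p.2.1 i)))

/-- `γ` restricted to `[0,1]` parametrizes the set `Γ` as a simple curve: it is continuous, has image
`Γ`, and is injective except that `γ 0 = γ 1` is allowed (simple arcs and simple closed curves). -/
structure IsSimpleParam (γ : ℝ → Plane) (Γ : Set Plane) : Prop where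
  continuousOn : ContinuousOn γ (Icc 0 1)
  injOn_left : InjOn γ (Ico 0 1)
  injOn_right : InjOn γ (Ioc 0 1)
  image_eq : γ '' Icc 0 1 = Γ

/-- The length `len_B Γ` of a rectifiable simple curve `Γ` (an arc or a closed curve), given as a set:
the length of its simple parametrizations, all of which have the same length. It is `0` for the empty
set and for a single point. -/
def lenB (B Γ : Set Plane) : ℝ :=
  (⨅ (γ : ℝ → Plane) (_ : IsSimpleParam γ Γ), pathLen B γ).toReal

open scoped Classical in
/-- The perimeter of a compact convex set in the seminorm with unit ball `B`. -/
def perB (B K : Set Plane) : ℝ :=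
  if (interior K).Nonempty then lenB B (frontier K) else 2 * lenB B K

/-- The perimeter-covariogram `x ↦ per_B (K ∩ (K + x))`. -/
def perCovariogram (B K : Set Plane) (x : Plane) : ℝ :=
  perB B (K ∩ ((fun y => y + x) '' K))

/-! ### Boundary arcs, one-sided tangents, inscribed parallelograms and caps -/

/-- The point with polar coordinates `(r, θ)` with respect to the centre `c`. -/
def polarPt (c : Plane) (r θ : ℝ) : Plane := c + r • !₂[Real.cos θ, Real.sin θ]

/-- The closed boundary arc `[a, b]_{bd K}`: the points of `bd K` met when one moves on `bd K`
counterclockwise from `a` to `b`. The counterclockwise order on `bd K` is the order of the polar angles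
around an interior point `c` of `K`; it does not depend on the choice of `c`. -/
def bdArc (K : Set Plane) (a b : Plane) : Set Plane :=
  {y | y ∈ frontier K ∧ ∃ c ∈ interior K, ∃ α θ β rₐ r r_b : ℝ,
    α ≤ θ ∧ θ ≤ β ∧ β < α + 2 * Real.pi ∧ 0 < rₐ ∧ 0 < r ∧ 0 < r_b ∧
    a = polarPt c rₐ α ∧ y = polarPt c r θ ∧ b = polarPt c r_b β}

/-- `u` is the direction of the half-tangent at `p` to the portion of `bd K` which follows `p` in
counterclockwise order: `u` is the limit of the secant directions `(y - p) / ‖y - p‖` as `y → p`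
within that portion. Around an interior point `c`, the boundary points `y` that follow `p` by
a polar angle in `(0, π)` are those with `det2 (p - c) (y - c) > 0`; near `p`, this is the same set for
every `c`. -/
def IsRightTangentDir (K : Set Plane) (p u : Plane) : Prop :=
  ∀ c ∈ interior K, Tendsto (fun y => ‖y - p‖⁻¹ • (y - p))
    (𝓝[{y | y ∈ frontier K ∧ 0 < det2 (p - c) (y - c)}] p) (𝓝 u)

/-- The same for the portion of `bd K` which precedes `p`. -/
def IsLeftTangentDir (K : Set Plane) (p u : Plane) : Prop :=
  ∀ c ∈ interior K, Tendsto (fun y => ‖y - p‖⁻¹ • (y - p))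
    (𝓝[{y | y ∈ frontier K ∧ det2 (p - c) (y - c) < 0}] p) (𝓝 u)

/-- The right tangent of `K` at the boundary point `p`, a line through `p`. -/
def rightTangent (K : Set Plane) (p : Plane) : Set Plane :=
  {q | ∃ u, IsRightTangentDir K p u ∧ ∃ s : ℝ, q = p + s • u}

/-- The left tangent of `K` at the boundary point `p`, a line through `p`. -/
def leftTangent (K : Set Plane) (p : Plane) : Set Plane :=
  {q | ∃ u, IsLeftTangentDir K p u ∧ ∃ s : ℝ, q = p + s • u}

/-- `p₁, p₂, p₃, p₄` are, in counterclockwise order, the vertices of a (nondegenerate) parallelogram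
inscribed in `K` with two opposite edges that are translates of `[o, x]`, labelled so that
`x = p₁ - p₂ = p₄ - p₃`. -/
structure IsInscribedParallelogram (K : Set Plane) (x p₁ p₂ p₃ p₄ : Plane) : Prop where
  mem₁ : p₁ ∈ frontier K
  mem₂ : p₂ ∈ frontier K
  mem₃ : p₃ ∈ frontier K
  mem₄ : p₄ ∈ frontier K
  eq₁₂ : x = p₁ - p₂
  eq₄₃ : x = p₄ - p₃
  ccw : 0 < det2 (p₂ - p₁) (p₃ - p₁)

/-- `q` is an admissible apex of the cap over the boundary arc from `a` to `b`: if the arc is the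
segment `[a, b]`, any point of that segment; otherwise the intersection point of the right tangent at
`a` and the left tangent at `b`. -/
def IsCapApex (K : Set Plane) (a b q : Plane) : Prop :=
  (bdArc K a b = segment ℝ a b ∧ q ∈ segment ℝ a b) ∨
  (bdArc K a b ≠ segment ℝ a b ∧ q ∈ rightTangent K a ∧ q ∈ leftTangent K b)

/-- The cap: the polygonal line `[a, q] ∪ [q, b]`. -/
def capSet (a q b : Plane) : Set Plane := segment ℝ a q ∪ segment ℝ q b

end

/-!
Choose coordinates `v = s • e + y • x` in which `x` is vertical, so that `K` is the region between the
graphs of a convex function `f` and a concave function `g` over `[a, b]` (`IsGraphBody`). For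
`0 ≤ t ≤ 1`, the set `K ∩ (K + t x)` is the region between `f + t` and `g` over the interval
`[α, β]` on which the concave width `h = g - f` is at least `t`. Its perimeter is therefore the length of
the two graphs over `[α, β]` plus `‖x‖_B` times `(h α - t) + (h β - t)`
(`IsGraphBody.perB_eq`, `IsGraphBody.perCovariogram_eq`). It splits at any `s₀` with `h s₀ > 1` into a left
and a right part, and the right part is a left part in the basis rotated by `π`; so only the left part has
to be differentiated.

The edge `[p₂, p₁]` of an inscribed parallelogram is a vertical chord at the left end `s₁ = α 1`.
If it lies on the edge `s = a` of `K`, then `α` does not move and the left part is linear in `t` with slope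
`-‖x‖_B`, the cap being the chord itself. Otherwise `h (α t) = t`, and as `t` decreases to the left of `1`
the boundary gains the pieces of the two graphs over `[α t, s₁]`. With the left derivatives
`mg`, `mf` of `g`, `f` at `s₁`, these have length about `(s₁ - α t) ‖e + m • x‖_B`, while `1 - t` is about
`(mg - mf) (s₁ - α t)`. The rate of growth `(‖e + mg • x‖_B + ‖e + mf • x‖_B) / (mg - mf)` is the
length of the two sides of the triangle over the chord cut out by the two tangents, that is, of the cap
(`IsGraphBody.hasDerivWithinAt_leftLen_cap`).

The lengths of sets in the statement are infima over all simple parametrizations. They are computed through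
`sum_arcLen_le_sum_arcLen`: if finitely many essentially disjoint simple curves are covered by finitely many
other curves, then their total length is not larger. The covering curves carry measures that dominate the
distance between the end points of every connected piece, so no comparison of the parametrizations is
needed; independence of the parametrization and additivity both follow.
-/

open MeasureTheory

/-! ### Length of a curve in a seminorm -/

/-- The plane equipped with the (possibly degenerate) distance of the seminorm `p`. -/
def SeminormedPlane (_p : Seminorm ℝ Plane) : Type := Plane

noncomputable instance (p : Seminorm ℝ Plane) : SeminormedAddCommGroup (SeminormedPlane p) :=
  p.toAddGroupSeminorm.toSeminormedAddCommGroup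

/-- The length in the seminorm `p` of the curve `γ` restricted to the parameter set `S`. -/
noncomputable def arcLen (p : Seminorm ℝ Plane) (γ : ℝ → Plane) (S : Set ℝ) : ℝ≥0∞ :=
  eVariationOn (E := SeminormedPlane p) γ S

lemma edist_seminormedPlane (p : Seminorm ℝ Plane) (u v : Plane) :
    edist (α := SeminormedPlane p) u v = ENNReal.ofReal (p (u - v)) := by
  refine (@edist_dist (SeminormedPlane p) _ u v).trans (congrArg ENNReal.ofReal ?_)
  refine (@SeminormedAddCommGroup.dist_eq (SeminormedPlane p) _ u v).trans ?_
  change p (-u + v) = _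
  rw [← map_neg_eq_map p, neg_add_rev, neg_neg, neg_add_eq_sub]

lemma arcLen_def (p : Seminorm ℝ Plane) (γ : ℝ → Plane) (S : Set ℝ) :
    arcLen p γ S = ⨆ q : ℕ × {u : ℕ → ℝ // Monotone u ∧ ∀ i, u i ∈ S},
      ∑ i ∈ Finset.range q.1, ENNReal.ofReal (p (γ (q.2.1 (i + 1)) - γ (q.2.1 i))) := by
  unfold arcLen eVariationOn
  simp only [edist_seminormedPlane]

lemma arcLen_mono_sub {p : Seminorm ℝ Plane} {γ γ' : ℝ → Plane} {S : Set ℝ}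
    (h : ∀ s ∈ S, ∀ t ∈ S, p (γ t - γ s) ≤ p (γ' t - γ' s)) : arcLen p γ S ≤ arcLen p γ' S := by
  rw [arcLen_def, arcLen_def]
  exact iSup_mono fun q => Finset.sum_le_sum fun i _ =>
    ENNReal.ofReal_le_ofReal (h _ (q.2.2.2 _) _ (q.2.2.2 _))

lemma arcLen_congr_sub {p : Seminorm ℝ Plane} {γ γ' : ℝ → Plane} {S : Set ℝ}
    (h : ∀ s ∈ S, ∀ t ∈ S, γ t - γ s = γ' t - γ' s) : arcLen p γ S = arcLen p γ' S :=
  le_antisymm (arcLen_mono_sub fun s hs t ht => by rw [h s hs t ht])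
    (arcLen_mono_sub fun s hs t ht => by rw [h s hs t ht])

lemma ofReal_le_arcLen {p : Seminorm ℝ Plane} (γ : ℝ → Plane) {S : Set ℝ} {s t : ℝ}
    (hs : s ∈ S) (ht : t ∈ S) : ENNReal.ofReal (p (γ t - γ s)) ≤ arcLen p γ S := by
  rw [← edist_seminormedPlane]
  exact eVariationOn.edist_le (E := SeminormedPlane p) γ ht hs

lemma arcLen_le_of_le_sub {p : Seminorm ℝ Plane} {γ : ℝ → Plane} {F : ℝ → ℝ} {a b : ℝ}
    (hab : a ≤ b)
    (h : ∀ s ∈ Icc a b, ∀ t ∈ Icc a b, s ≤ t → p (γ t - γ s) ≤ F t - F s) :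
    arcLen p γ (Icc a b) ≤ ENNReal.ofReal (F b - F a) := by
  have hF : MonotoneOn F (Icc a b) := fun s hs t ht hst => by
    have := h s hs t ht hst
    have := apply_nonneg p (γ t - γ s)
    linarith
  have key := MonotoneOn.eVariationOn_eq hF (left_mem_Icc.2 hab) (right_mem_Icc.2 hab)
  rw [inter_self] at key
  rw [← key, arcLen_def]
  unfold eVariationOn
  refine iSup_mono fun q => Finset.sum_le_sum fun i _ => ?_
  rw [edist_dist]
  exact ENNReal.ofReal_le_ofReal
    ((h _ (q.2.2.2 _) _ (q.2.2.2 _) (q.2.2.1 (Nat.le_succ i))).trans (le_abs_self _))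

lemma arcLen_add (p : Seminorm ℝ Plane) (γ : ℝ → Plane) {a b c : ℝ} (hab : a ≤ b) (hbc : b ≤ c) :
    arcLen p γ (Icc a b) + arcLen p γ (Icc b c) = arcLen p γ (Icc a c) := by
  have := eVariationOn.Icc_add_Icc (E := SeminormedPlane p) γ (s := univ) hab hbc (mem_univ b)
  simp only [univ_inter] at this
  exact this

lemma arcLen_mono (p : Seminorm ℝ Plane) (γ : ℝ → Plane) {S T : Set ℝ} (h : S ⊆ T) :
    arcLen p γ S ≤ arcLen p γ T :=
  eVariationOn.mono (E := SeminormedPlane p) γ h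

lemma arcLen_comp_neg (p : Seminorm ℝ Plane) (γ : ℝ → Plane) (a b : ℝ) :
    arcLen p (fun s => γ (-s)) (Icc (-b) (-a)) = arcLen p γ (Icc a b) := by
  have := eVariationOn.comp_eq_of_antitoneOn (E := SeminormedPlane p) γ (t := Icc (-b) (-a))
    (fun s => -s) (fun _ _ _ _ h => neg_le_neg h)
  rw [image_neg_eq_neg, neg_Icc, neg_neg, neg_neg] at this
  exact this

/-- The image of a curve carries a measure of total mass at most its length plus `ε`, against which
the images of all `p`-Lipschitz functions can be compared: Lebesgue measure transported by
`t ↦ len (γ|[a,t]) + ε t`. Adding the multiple of the identity makes that map injective. -/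
lemma exists_measure_of_arcLen_ne_top (p : Seminorm ℝ Plane) {γ : ℝ → Plane} {a b : ℝ}
    (hab : a ≤ b) (hγ : ContinuousOn γ (Icc a b)) (hfin : arcLen p γ (Icc a b) ≠ ∞)
    {ε : ℝ} (hε : 0 < ε) :
    ∃ μ : Measure Plane, μ univ ≤ arcLen p γ (Icc a b) + ENNReal.ofReal (ε * (b - a)) ∧
      ∀ E : Set Plane, MeasurableSet E → ∀ φ : Plane → ℝ, (∀ u v, |φ u - φ v| ≤ p (u - v)) →
        volume (φ '' (E ∩ γ '' Icc a b)) ≤ μ E := by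
  have hfin' : ∀ t, arcLen p γ (Icc a b ∩ Iic t) ≠ ∞ := fun t =>
    ne_top_of_le_ne_top hfin (arcLen_mono p γ inter_subset_left)
  set v : ℝ → ℝ := fun t => (arcLen p γ (Icc a b ∩ Iic t)).toReal + ε * t with hv
  have hv0 : ∀ s t, s ≤ t → ε * (t - s) ≤ v t - v s := fun s t hst => by
    have := ENNReal.toReal_mono (hfin' t)
      (arcLen_mono p γ (inter_subset_inter_right (Icc a b) (Iic_subset_Iic.2 hst)))
    simp only [hv]; linarith
  have hmono : StrictMono v := fun s t hst => by
    nlinarith [hv0 s t hst.le, mul_pos hε (sub_pos.2 hst)]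
  have hv1 : ∀ s ∈ Icc a b, ∀ t ∈ Icc a b, s ≤ t → p (γ t - γ s) ≤ v t - v s := by
    intro s hs t ht hst
    have h1 : arcLen p γ (Icc a b ∩ Iic s) + arcLen p γ (Icc s t)
        ≤ arcLen p γ (Icc a b ∩ Iic t) := by
      refine (eVariationOn.add_le_union (E := SeminormedPlane p) γ ?_).trans
        (eVariationOn.mono (E := SeminormedPlane p) γ ?_)
      · rintro x ⟨-, hx⟩ y ⟨hy, -⟩
        exact le_trans hx hy
      · rintro x (⟨hx, hx'⟩ | ⟨hx, hx'⟩)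
        · exact ⟨hx, le_trans hx' hst⟩
        · exact ⟨⟨hs.1.trans hx, hx'.trans ht.2⟩, hx'⟩
    have h2 := (add_le_add_right (ofReal_le_arcLen (p := p) γ (left_mem_Icc.2 hst)
      (right_mem_Icc.2 hst)) (arcLen p γ (Icc a b ∩ Iic s))).trans h1
    have h3 := ENNReal.toReal_mono (hfin' t) h2
    rw [ENNReal.toReal_add (hfin' s) ENNReal.ofReal_ne_top,
      ENNReal.toReal_ofReal (apply_nonneg p _)] at h3
    have := mul_nonneg hε.le (sub_nonneg.2 hst)
    simp only [hv]; linarith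
  have hemb : MeasurableEmbedding v :=
    hmono.monotone.measurable.measurableEmbedding hmono.injective
  have hae : AEMeasurable γ ((volume.comap v).restrict (Icc a b)) :=
    hγ.aemeasurable measurableSet_Icc
  refine ⟨((volume.comap v).restrict (Icc a b)).map γ, ?_, fun E hE φ hφ => ?_⟩
  · rw [Measure.map_apply_of_aemeasurable hae MeasurableSet.univ, preimage_univ,
      Measure.restrict_apply_univ, hemb.comap_apply]
    calc volume (v '' Icc a b) ≤ volume (Icc (v a) (v b)) :=
          measure_mono (by
            rintro _ ⟨t, ht, rfl⟩
            exact ⟨hmono.monotone ht.1, hmono.monotone ht.2⟩)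
      _ = ENNReal.ofReal (v b - v a) := Real.volume_Icc
      _ ≤ ENNReal.ofReal ((arcLen p γ (Icc a b)).toReal + ε * (b - a)) := by
          refine ENNReal.ofReal_le_ofReal ?_
          have h1 := ENNReal.toReal_mono hfin
            (arcLen_mono p γ (inter_subset_left (s := Icc a b) (t := Iic b)))
          have h2 : 0 ≤ (arcLen p γ (Icc a b ∩ Iic a)).toReal := ENNReal.toReal_nonneg
          simp only [hv]; linarith
      _ = _ := by
          rw [ENNReal.ofReal_add ENNReal.toReal_nonneg
            (mul_nonneg hε.le (sub_nonneg.2 hab)), ENNReal.ofReal_toReal hfin]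
  · rw [Measure.map_apply_of_aemeasurable hae hE]
    refine le_trans ?_ (Measure.le_restrict_apply _ _)
    rw [hemb.comap_apply]
    set A := γ ⁻¹' E ∩ Icc a b with hA
    have himg : φ '' (E ∩ γ '' Icc a b) = (φ ∘ γ ∘ Function.invFun v) '' (v '' A) := by
      ext y
      constructor
      · rintro ⟨_, ⟨hE', t, ht, rfl⟩, rfl⟩
        refine ⟨v t, ⟨t, ⟨hE', ht⟩, rfl⟩, ?_⟩
        simp [Function.leftInverse_invFun hmono.injective t]
      · rintro ⟨_, ⟨t, ⟨hE', ht⟩, rfl⟩, rfl⟩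
        refine ⟨γ t, ⟨hE', t, ht, rfl⟩, ?_⟩
        simp [Function.leftInverse_invFun hmono.injective t]
    have hlip : LipschitzOnWith 1 (φ ∘ γ ∘ Function.invFun v) (v '' A) := by
      refine LipschitzOnWith.of_dist_le_mul ?_
      rintro _ ⟨s, ⟨-, hs⟩, rfl⟩ _ ⟨t, ⟨-, ht⟩, rfl⟩
      simp only [Function.comp_apply, Function.leftInverse_invFun hmono.injective _,
        NNReal.coe_one, one_mul, Real.dist_eq]
      refine (hφ _ _).trans ?_
      rcases le_total s t with h | h
      · rw [abs_sub_comm, map_sub_rev]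
        exact (hv1 s hs t ht h).trans (le_abs_self _)
      · exact (hv1 t ht s hs h).trans (le_abs_self _)
    rw [himg]
    have := hlip.hausdorffMeasure_image_le (d := 1) zero_le_one
    rwa [ENNReal.coe_one, ENNReal.one_rpow, one_mul, hausdorffMeasure_real] at this

/-- Over each interval of a partition, the function `z ↦ p (z - δ (u i))` attains on the open arc every
value between `0` and the distance of the end points, so this distance is at most the measure of the
arc. -/
lemma arcLen_le_measure {p : Seminorm ℝ Plane} (hp : Continuous p) {μ : Measure Plane}
    {δ : ℝ → Plane} {c d : ℝ} (hδ : ContinuousOn δ (Icc c d)) (hinj : InjOn δ (Ioo c d))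
    (hμ : ∀ E : Set Plane, MeasurableSet E → E ⊆ δ '' Ioo c d →
      ∀ φ : Plane → ℝ, (∀ u v, |φ u - φ v| ≤ p (u - v)) → volume (φ '' E) ≤ μ E) :
    arcLen p δ (Icc c d) ≤ μ (δ '' Ioo c d) := by
  rw [arcLen_def]
  refine iSup_le fun q => ?_
  obtain ⟨n, u, hu, hmem⟩ := q
  have hsub : ∀ i, Ioo (u i) (u (i + 1)) ⊆ Ioo c d := fun i =>
    Ioo_subset_Ioo (hmem i).1 (hmem (i + 1)).2
  have hmeas : ∀ i, MeasurableSet (δ '' Ioo (u i) (u (i + 1))) := fun i =>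
    measurableSet_Ioo.image_of_continuousOn_injOn
      (hδ.mono ((hsub i).trans Ioo_subset_Icc_self)) (hinj.mono (hsub i))
  have hterm : ∀ i, ENNReal.ofReal (p (δ (u (i + 1)) - δ (u i))) ≤
      μ (δ '' Ioo (u i) (u (i + 1))) := by
    intro i
    set φ : Plane → ℝ := fun z => p (z - δ (u i)) with hφ
    have hφL : ∀ z z', |φ z - φ z'| ≤ p (z - z') := fun z z' => by
      have := abs_sub_map_le_sub p (z - δ (u i)) (z' - δ (u i))
      rwa [sub_sub_sub_cancel_right] at this
    have hφc : Continuous φ := hp.comp (continuous_id.sub continuous_const)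
    refine le_trans ?_ (hμ _ (hmeas i) (image_mono (hsub i)) φ hφL)
    have hivt := intermediate_value_Ioo (hu (Nat.le_succ i))
      (f := φ ∘ δ) (hφc.comp_continuousOn
        (hδ.mono (Icc_subset_Icc (hmem i).1 (hmem (i + 1)).2)))
    rw [image_comp] at hivt
    refine le_trans (le_of_eq ?_) (measure_mono hivt)
    simp [hφ]
  calc ∑ i ∈ Finset.range n, ENNReal.ofReal (p (δ (u (i + 1)) - δ (u i)))
      ≤ ∑ i ∈ Finset.range n, μ (δ '' Ioo (u i) (u (i + 1))) :=
        Finset.sum_le_sum fun i _ => hterm i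
    _ = μ (⋃ i ∈ Finset.range n, δ '' Ioo (u i) (u (i + 1))) := by
        refine (measure_biUnion_finset ?_ fun i _ => hmeas i).symm
        intro i _ j _ hij
        exact (hu.pairwise_disjoint_on_Ioo_succ hij).image hinj (hsub i) (hsub j)
    _ ≤ μ (δ '' Ioo c d) := measure_mono (iUnion₂_subset fun i _ => image_mono (hsub i))

/-- Comparison of lengths: if finitely many curves `δ k`, injective and pairwise disjoint up to their
end points, run inside the union of finitely many curves `γ i`, then their total length is at most
that of the `γ i`. No relation between the parametrizations is assumed; in particular, the length
of a simple curve depends only on its image and is additive. -/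
theorem sum_arcLen_le_sum_arcLen {p : Seminorm ℝ Plane} (hp : Continuous p) {ι κ : Type*}
    [Fintype ι] [Fintype κ] {γ : ι → ℝ → Plane} {a b : ι → ℝ} {δ : κ → ℝ → Plane} {c d : κ → ℝ}
    (hab : ∀ i, a i ≤ b i) (hγ : ∀ i, ContinuousOn (γ i) (Icc (a i) (b i)))
    (hδ : ∀ k, ContinuousOn (δ k) (Icc (c k) (d k))) (hinj : ∀ k, InjOn (δ k) (Ioo (c k) (d k)))
    (hdisj : Pairwise fun k l => Disjoint (δ k '' Ioo (c k) (d k)) (δ l '' Ioo (c l) (d l)))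
    (hcover : ∀ k, δ k '' Ioo (c k) (d k) ⊆ ⋃ i, γ i '' Icc (a i) (b i)) :
    ∑ k, arcLen p (δ k) (Icc (c k) (d k)) ≤ ∑ i, arcLen p (γ i) (Icc (a i) (b i)) := by
  by_cases hfin : ∀ i, arcLen p (γ i) (Icc (a i) (b i)) ≠ ∞
  swap
  · push Not at hfin
    obtain ⟨i, hi⟩ := hfin
    rw [(ENNReal.sum_eq_top (s := Finset.univ)).2 ⟨i, Finset.mem_univ i, hi⟩]
    exact le_top
  have key : ∀ ε : ℝ, 0 < ε → ∑ k, arcLen p (δ k) (Icc (c k) (d k)) ≤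
      ∑ i, arcLen p (γ i) (Icc (a i) (b i)) + ENNReal.ofReal (ε * ∑ i, (b i - a i)) := by
    intro ε hε
    choose μ hμ1 hμ2 using fun i =>
      exists_measure_of_arcLen_ne_top p (hab i) (hγ i) (hfin i) hε
    have h1 : ∀ k, arcLen p (δ k) (Icc (c k) (d k)) ≤ (∑ i, μ i) (δ k '' Ioo (c k) (d k)) := by
      intro k
      refine arcLen_le_measure hp (hδ k) (hinj k) fun E hE hsub φ hφ => ?_
      have : φ '' E ⊆ ⋃ i ∈ Finset.univ, φ '' (E ∩ γ i '' Icc (a i) (b i)) := by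
        rintro _ ⟨z, hz, rfl⟩
        obtain ⟨i, hi⟩ := mem_iUnion.1 (hcover k (hsub hz))
        exact mem_iUnion₂.2 ⟨i, Finset.mem_univ i, z, ⟨hz, hi⟩, rfl⟩
      refine (measure_mono this).trans ((measure_biUnion_finset_le _ _).trans ?_)
      rw [Measure.finsetSum_apply]
      exact Finset.sum_le_sum fun i _ => hμ2 i E hE φ hφ
    calc ∑ k, arcLen p (δ k) (Icc (c k) (d k))
        ≤ ∑ k, (∑ i, μ i) (δ k '' Ioo (c k) (d k)) := Finset.sum_le_sum fun k _ => h1 k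
      _ = (∑ i, μ i) (⋃ k ∈ Finset.univ, δ k '' Ioo (c k) (d k)) := by
          refine (measure_biUnion_finset (fun k _ l _ hkl => hdisj hkl) fun k _ => ?_).symm
          exact measurableSet_Ioo.image_of_continuousOn_injOn
            ((hδ k).mono Ioo_subset_Icc_self) (hinj k)
      _ ≤ (∑ i, μ i) univ := measure_mono (subset_univ _)
      _ ≤ ∑ i, (arcLen p (γ i) (Icc (a i) (b i)) + ENNReal.ofReal (ε * (b i - a i))) := by
          rw [Measure.finsetSum_apply]
          exact Finset.sum_le_sum fun i _ => hμ1 i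
      _ = _ := by
          rw [Finset.sum_add_distrib, Finset.mul_sum, ENNReal.ofReal_sum_of_nonneg]
          exact fun i _ => mul_nonneg hε.le (sub_nonneg.2 (hab i))
  have hlim : Tendsto (fun ε : ℝ => ∑ i, arcLen p (γ i) (Icc (a i) (b i)) +
      ENNReal.ofReal (ε * ∑ i, (b i - a i))) (𝓝[>] 0)
      (𝓝 (∑ i, arcLen p (γ i) (Icc (a i) (b i)) + ENNReal.ofReal (0 * ∑ i, (b i - a i)))) := by
    refine Tendsto.const_add _ ?_
    refine ((ENNReal.continuous_ofReal.comp
      (continuous_id.mul continuous_const)).tendsto 0).mono_left nhdsWithin_le_nhds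
  rw [zero_mul, ENNReal.ofReal_zero, add_zero] at hlim
  exact ge_of_tendsto hlim (eventually_mem_nhdsWithin.mono fun ε hε => key ε hε)

/-! ### Lengths of simple curves -/

/-- The gauge of a seminorm ball, as a continuous seminorm. -/
lemma IsSeminormBall.exists_seminorm {B : Set Plane} (hB : IsSeminormBall B) :
    ∃ p : Seminorm ℝ Plane, Continuous p ∧ ∀ v, p v = gauge B v := by
  obtain ⟨c, hc⟩ := hB.interior_nonempty
  have hneg : ∀ v ∈ B, -v ∈ B := fun v hv => by
    rw [← hB.symm]; simpa using hv
  have hnegi : -c ∈ interior B := by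
    rw [← hB.symm, ← Set.image_neg_eq_neg]
    exact (Homeomorph.neg Plane).image_interior B ▸ mem_image_of_mem _ hc
  have h0 : (0 : Plane) ∈ interior B := by
    have := hB.convex.interior hc hnegi (a := 1 / 2) (b := 1 / 2) (by norm_num) (by norm_num)
      (by norm_num)
    simpa using this
  have hnhds : B ∈ 𝓝 (0 : Plane) := mem_interior_iff_mem_nhds.1 h0
  have habs : Absorbent ℝ B := absorbent_nhds_zero hnhds
  refine ⟨Seminorm.of (gauge B) (gauge_add_le hB.convex habs) fun a v => ?_,
    continuous_gauge hB.convex hnhds, fun v => rfl⟩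
  rcases le_total 0 a with ha | ha
  · rw [gauge_smul_of_nonneg ha, Real.norm_of_nonneg ha, smul_eq_mul]
  · have : a • v = (-a) • (-v) := by simp
    rw [this, gauge_smul_of_nonneg (neg_nonneg.2 ha), gauge_neg hneg,
      Real.norm_of_nonpos ha, smul_eq_mul]

lemma pathLen_eq_arcLen {B : Set Plane} {p : Seminorm ℝ Plane} (hpB : ∀ v, p v = gauge B v)
    (γ : ℝ → Plane) : pathLen B γ = arcLen p γ (Icc 0 1) := by
  rw [arcLen_def]
  simp only [pathLen, hpB]

/-- The length of a simple curve that is a union of finitely many simple curves which are disjoint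
up to their end points. -/
lemma lenB_eq_sum_arcLen {B : Set Plane} {p : Seminorm ℝ Plane} (hp : Continuous p)
    (hpB : ∀ v, p v = gauge B v) {Γ : Set Plane} (hΓ : ∃ γ, IsSimpleParam γ Γ)
    {ι : Type*} [Fintype ι] {γ : ι → ℝ → Plane} {a b : ι → ℝ} (hab : ∀ i, a i ≤ b i)
    (hγ : ∀ i, ContinuousOn (γ i) (Icc (a i) (b i))) (hinj : ∀ i, InjOn (γ i) (Ioo (a i) (b i)))
    (hdisj : Pairwise fun k l => Disjoint (γ k '' Ioo (a k) (b k)) (γ l '' Ioo (a l) (b l)))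
    (hunion : Γ = ⋃ i, γ i '' Icc (a i) (b i)) :
    lenB B Γ = (∑ i, arcLen p (γ i) (Icc (a i) (b i))).toReal := by
  have key : ∀ δ, IsSimpleParam δ Γ → pathLen B δ = ∑ i, arcLen p (γ i) (Icc (a i) (b i)) := by
    intro δ hδ
    rw [pathLen_eq_arcLen hpB]
    apply le_antisymm
    · have := sum_arcLen_le_sum_arcLen hp (κ := Unit) (δ := fun _ => δ) (c := fun _ => 0)
        (d := fun _ => 1) hab hγ (fun _ => hδ.continuousOn)
        (fun _ => hδ.injOn_left.mono Ioo_subset_Ico_self) (fun k l h => (h rfl).elim)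
        (fun _ => by
          rw [← hunion, ← hδ.image_eq]; exact image_mono Ioo_subset_Icc_self)
      simpa using this
    · have := sum_arcLen_le_sum_arcLen hp (ι := Unit) (γ := fun _ => δ) (a := fun _ => 0)
        (b := fun _ => 1) (fun _ => zero_le_one) (fun _ => hδ.continuousOn) hγ hinj hdisj
        (fun k => by
          simp only [iUnion_const]
          rw [hδ.image_eq, hunion]
          exact (image_mono Ioo_subset_Icc_self).trans (subset_iUnion_of_subset k subset_rfl))
      simpa using this
  obtain ⟨δ, hδ⟩ := hΓ
  rw [lenB]
  congr 1
  exact le_antisymm ((iInf₂_le δ hδ).trans (key δ hδ).le) (le_iInf₂ fun δ hδ => (key δ hδ).ge)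

lemma arcLen_line {p : Seminorm ℝ Plane} (u v : Plane) {a b : ℝ} (hab : a ≤ b) :
    arcLen p (fun s => u + s • v) (Icc a b) = ENNReal.ofReal ((b - a) * p v) := by
  have hsub : ∀ s t : ℝ, (u + t • v) - (u + s • v) = (t - s) • v := fun s t => by
    rw [sub_smul]; abel
  apply le_antisymm
  · have := arcLen_le_of_le_sub (p := p) (γ := fun s => u + s • v) (F := fun s => s * p v) hab
      (fun s _ t _ hst => by
        rw [hsub, map_smul_eq_mul, Real.norm_of_nonneg (sub_nonneg.2 hst), sub_mul])
    rwa [← sub_mul] at this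
  · have := ofReal_le_arcLen (p := p) (fun s => u + s • v) (left_mem_Icc.2 hab)
      (right_mem_Icc.2 hab)
    rwa [hsub, map_smul_eq_mul, Real.norm_of_nonneg (sub_nonneg.2 hab)] at this

lemma segment_eq_image_add_smul (u v : Plane) :
    segment ℝ u v = (fun s : ℝ => u + s • (v - u)) '' Icc 0 1 :=
  segment_eq_image' ℝ u v

lemma injective_add_smul (u : Plane) {v : Plane} (hv : v ≠ 0) :
    Function.Injective fun s : ℝ => u + s • v := fun _ _ h =>
  smul_left_injective ℝ hv (add_left_cancel h)

lemma lenB_segment {B : Set Plane} {p : Seminorm ℝ Plane} (hp : Continuous p)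
    (hpB : ∀ v, p v = gauge B v) {u v : Plane} (huv : u ≠ v) :
    lenB B (segment ℝ u v) = p (v - u) := by
  have hinj := injective_add_smul u (sub_ne_zero.2 huv.symm)
  have hcont : Continuous fun s : ℝ => u + s • (v - u) := by fun_prop
  rw [lenB_eq_sum_arcLen hp hpB (ι := Unit) (γ := fun _ s => u + s • (v - u)) (a := fun _ => 0)
    (b := fun _ => 1) ⟨_, hcont.continuousOn, hinj.injOn, hinj.injOn,
      (segment_eq_image_add_smul u v).symm⟩ (fun _ => zero_le_one) (fun _ => hcont.continuousOn)
      (fun _ => hinj.injOn) (fun k l h => (h rfl).elim)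
      (by rw [iUnion_const, segment_eq_image_add_smul])]
  simp [arcLen_line u (v - u) zero_le_one, apply_nonneg]

lemma det2_smul_left (r : ℝ) (u v : Plane) : det2 (r • u) v = r * det2 u v := by
  simp [det2]; ring

lemma det2_smul_right (r : ℝ) (u v : Plane) : det2 u (r • v) = r * det2 u v := by
  simp [det2]; ring

lemma det2_add_left (u u' v : Plane) : det2 (u + u') v = det2 u v + det2 u' v := by
  simp [det2]; ring

lemma det2_add_right (u v v' : Plane) : det2 u (v + v') = det2 u v + det2 u v' := by
  simp [det2]; ring

lemma det2_neg_left (u v : Plane) : det2 (-u) v = -det2 u v := by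
  simp [det2]; ring

lemma det2_neg_right (u v : Plane) : det2 u (-v) = -det2 u v := by
  simp [det2]; ring

@[simp] lemma det2_self (u : Plane) : det2 u u = 0 := by
  simp [det2]; ring

/-- The cap with edge vectors `A = q - u` and `C = v - q`. -/
lemma lenB_capSet {B : Set Plane} {p : Seminorm ℝ Plane} (hp : Continuous p)
    (hpB : ∀ v, p v = gauge B v) {u q v : Plane} (hdet : det2 (q - u) (v - q) ≠ 0) :
    lenB B (capSet u q v) = p (q - u) + p (v - q) := by
  set A := q - u with hA
  set C := v - q with hC
  have hA0 : A ≠ 0 := by rintro h; rw [h] at hdet; simp [det2] at hdet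
  have hC0 : C ≠ 0 := by rintro h; rw [h] at hdet; simp [det2] at hdet
  have hq : q = u + A := by simp [hA]
  have hcomb : ∀ {r r' s s' : ℝ}, u + r • A + s • C = u + r' • A + s' • C → r = r' ∧ s = s' := by
    intro r r' s s' h
    have h1 : (r - r') • A + (s - s') • C = 0 := by
      rw [← sub_eq_zero] at h
      rw [← h]
      module
    have h2 := congrArg (fun z => det2 z C) h1
    have h3 := congrArg (fun z => det2 A z) h1
    simp only [det2_add_left, det2_add_right, det2_smul_left, det2_smul_right, det2_self] at h2 h3
    have z1 : det2 0 C = 0 := by simp [det2]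
    have z2 : det2 A 0 = 0 := by simp [det2]
    rw [z1, mul_zero, add_zero] at h2
    rw [z2, mul_zero, zero_add] at h3
    exact ⟨sub_eq_zero.1 ((mul_eq_zero.1 h2).resolve_right hdet),
      sub_eq_zero.1 ((mul_eq_zero.1 h3).resolve_right hdet)⟩
  have hset : capSet u q v = (fun s : ℝ => u + s • A) '' Icc 0 1 ∪
      (fun s : ℝ => q + s • C) '' Icc 0 1 := by
    rw [capSet, segment_eq_image_add_smul, segment_eq_image_add_smul]
  have hparam : ∃ γ, IsSimpleParam γ (capSet u q v) := by
    set γ : ℝ → Plane := fun t => u + min (2 * t) 1 • A + max (2 * t - 1) 0 • C with hγ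
    have hinj : Function.Injective γ := fun s t h => by
      obtain ⟨h1, h2⟩ := hcomb h
      have key : ∀ t : ℝ, min (2 * t) 1 + max (2 * t - 1) 0 = 2 * t := fun t => by
        rcases le_total (2 * t) 1 with h | h
        · rw [min_eq_left h, max_eq_right (by linarith)]; ring
        · rw [min_eq_right h, max_eq_left (by linarith)]; ring
      linarith [key s, key t]
    refine ⟨γ, Continuous.continuousOn (by fun_prop), hinj.injOn, hinj.injOn, ?_⟩
    rw [hset]
    ext z
    constructor
    · rintro ⟨t, ⟨h0, h1⟩, rfl⟩
      rcases le_total (2 * t) 1 with h | h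
      · left
        exact ⟨2 * t, ⟨by linarith, h⟩, by
          simp only [hγ]; rw [min_eq_left h, max_eq_right (by linarith)]; simp⟩
      · right
        exact ⟨2 * t - 1, ⟨by linarith, by linarith⟩, by
          simp only [hγ]; rw [min_eq_right h, max_eq_left (by linarith), hq]; simp⟩
    · rintro (⟨s, ⟨h0, h1⟩, rfl⟩ | ⟨s, ⟨h0, h1⟩, rfl⟩)
      · refine ⟨s / 2, ⟨by linarith, by linarith⟩, ?_⟩
        simp only [hγ]
        rw [mul_div_cancel₀ s two_ne_zero, min_eq_left h1, max_eq_right (by linarith)]; simp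
      · refine ⟨(s + 1) / 2, ⟨by linarith, by linarith⟩, ?_⟩
        simp only [hγ]
        rw [mul_div_cancel₀ (s + 1) two_ne_zero, min_eq_right (by linarith),
          max_eq_left (by linarith), hq]; simp
  rw [lenB_eq_sum_arcLen hp hpB (ι := Bool)
    (γ := fun i => bif i then fun s => u + s • A else fun s => q + s • C) (a := fun _ => 0)
    (b := fun _ => 1) hparam (fun _ => zero_le_one)]
  · simp [arcLen_line _ _ zero_le_one, ENNReal.toReal_add, apply_nonneg]
  · rintro (_ | _) <;> exact Continuous.continuousOn (by simp only [cond_true, cond_false]; fun_prop)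
  · rintro (_ | _)
    exacts [(injective_add_smul q hC0).injOn, (injective_add_smul u hA0).injOn]
  · have : Disjoint ((fun s : ℝ => u + s • A) '' Ioo 0 1) ((fun s : ℝ => q + s • C) '' Ioo 0 1) := by
      refine disjoint_image_image fun s hs t ht h => ?_
      have := (hcomb (r := s) (s := 0) (r' := 1) (s' := t) (by simpa [hq] using h)).1
      exact hs.2.ne this
    rintro (_ | _) (_ | _) h
    exacts [(h rfl).elim, this.symm, this, (h rfl).elim]
  · rw [hset, union_eq_iUnion]
    congr 1
    ext i
    cases i <;> rfl

/-! ### The boundary of a convex body as a simple closed curve -/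

lemma exists_angle_of_ne_zero {v : Plane} (hv : v ≠ 0) :
    ∃ r θ : ℝ, 0 < r ∧ v = r • !₂[Real.cos θ, Real.sin θ] := by
  set z : ℂ := ⟨v 0, v 1⟩ with hz
  have hz0 : z ≠ 0 := by
    intro h
    apply hv
    ext i
    fin_cases i
    · simpa [hz] using congrArg Complex.re h
    · simpa [hz] using congrArg Complex.im h
  refine ⟨‖z‖, z.arg, norm_pos_iff.2 hz0, ?_⟩
  ext i
  fin_cases i
  · simp [Complex.norm_mul_cos_arg, hz]
  · simp [Complex.norm_mul_sin_arg, hz]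

lemma norm_cos_sin (θ : ℝ) : ‖(!₂[Real.cos θ, Real.sin θ] : Plane)‖ = 1 := by
  simp [EuclideanSpace.norm_eq, Fin.sum_univ_two]

lemma exists_int_of_cos_sin_eq {θ ψ : ℝ}
    (h : (!₂[Real.cos θ, Real.sin θ] : Plane) = !₂[Real.cos ψ, Real.sin ψ]) :
    ∃ k : ℤ, θ - ψ = 2 * Real.pi * k := by
  have h0 := congrArg (fun z : Plane => z 0) h
  have h1 := congrArg (fun z : Plane => z 1) h
  simp at h0 h1
  exact Real.Angle.angle_eq_iff_two_pi_dvd_sub.1 (Real.Angle.cos_sin_inj h0 h1)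

/-- The boundary is parametrized by a homeomorphism of the plane that takes it to the unit circle. -/
lemma exists_isSimpleParam_frontier {L : Set Plane} (hconv : Convex ℝ L)
    (hne : (interior L).Nonempty) (hbdd : Bornology.IsBounded L) :
    ∃ γ, IsSimpleParam γ (frontier L) := by
  obtain ⟨h, -, -, hfr⟩ :=
    exists_homeomorph_image_interior_closure_frontier_eq_unitBall hconv hne hbdd
  set c : ℝ → Plane := fun t => !₂[Real.cos (2 * Real.pi * t), Real.sin (2 * Real.pi * t)] with hc
  have hcc : Continuous c := by
    refine (PiLp.continuous_toLp 2 _).comp (continuous_pi fun i => ?_)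
    fin_cases i
    · simpa using by fun_prop
    · simpa using by fun_prop
  have hinj : ∀ s t, |s - t| < 1 → c s = c t → s = t := by
    intro s t hst h
    obtain ⟨k, hk⟩ := exists_int_of_cos_sin_eq h
    have h1 : s - t = k := by
      have : 2 * Real.pi * (s - t) = 2 * Real.pi * k := by linarith
      exact mul_left_cancel₀ (by positivity) this
    rw [h1] at hst
    have h2 : |k| < 1 := by exact_mod_cast hst
    rw [Int.abs_lt_one_iff.1 h2] at h1
    simpa [sub_eq_zero] using h1
  have himg : c '' Icc 0 1 = Metric.sphere 0 1 := by
    apply Subset.antisymm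
    · rintro _ ⟨t, -, rfl⟩
      simp [hc, norm_cos_sin]
    · intro v hv
      have hv1 : ‖v‖ = 1 := by simpa using hv
      obtain ⟨r, θ, hr, hv'⟩ := exists_angle_of_ne_zero (v := v) (by
        rintro rfl; simp at hv1)
      have hr1 : r = 1 := by
        rw [hv', norm_smul, norm_cos_sin, mul_one, Real.norm_of_nonneg hr.le] at hv1
        exact hv1
      refine ⟨Int.fract (θ / (2 * Real.pi)), ⟨Int.fract_nonneg _, (Int.fract_lt_one _).le⟩, ?_⟩
      have : 2 * Real.pi * Int.fract (θ / (2 * Real.pi)) =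
          θ - ⌊θ / (2 * Real.pi)⌋ * (2 * Real.pi) := by
        rw [Int.fract, mul_sub, mul_div_cancel₀ θ (by positivity)]; ring
      simp only [hc]
      rw [this, Real.cos_sub_int_mul_two_pi, Real.sin_sub_int_mul_two_pi, hv', hr1, one_smul]
  refine ⟨fun t => h.symm (c t), (h.symm.continuous.comp hcc).continuousOn, ?_, ?_, ?_⟩
  · intro s hs t ht hst
    exact hinj s t (abs_sub_lt_iff.2 ⟨by linarith [hs.2, ht.1], by linarith [hs.1, ht.2]⟩)
      (h.symm.injective hst)
  · intro s hs t ht hst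
    exact hinj s t (abs_sub_lt_iff.2 ⟨by linarith [hs.2, ht.1], by linarith [hs.1, ht.2]⟩)
      (h.symm.injective hst)
  · rw [← Function.comp_def h.symm c, image_comp, himg, ← hfr, ← image_comp, h.symm_comp_self, image_id]

/-! ### Convex bodies between two graphs -/

/-- The first coordinate of `v` in the basis `(e, w)`. -/
noncomputable def coordFst (e w v : Plane) : ℝ := det2 v w / det2 e w

/-- The second coordinate of `v` in the basis `(e, w)`. -/
noncomputable def coordSnd (e w v : Plane) : ℝ := det2 e v / det2 e w

section Coordinates

variable {e w : Plane}

lemma continuous_coordFst : Continuous (coordFst e w) := by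
  unfold coordFst det2; fun_prop

lemma continuous_coordSnd : Continuous (coordSnd e w) := by
  unfold coordSnd det2; fun_prop

lemma coordFst_apply (h : det2 e w ≠ 0) (s y : ℝ) : coordFst e w (s • e + y • w) = s := by
  rw [coordFst, det2_add_left, det2_smul_left, det2_smul_left, det2_self, mul_zero, add_zero,
    mul_div_cancel_right₀ _ h]

lemma coordSnd_apply (h : det2 e w ≠ 0) (s y : ℝ) : coordSnd e w (s • e + y • w) = y := by
  rw [coordSnd, det2_add_right, det2_smul_right, det2_smul_right, det2_self, mul_zero, zero_add,
    mul_div_cancel_right₀ _ h]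

lemma coord_eq (h : det2 e w ≠ 0) (v : Plane) : coordFst e w v • e + coordSnd e w v • w = v := by
  ext i
  simp only [coordFst, coordSnd, PiLp.add_apply, PiLp.smul_apply, smul_eq_mul]
  rw [div_mul_eq_mul_div, div_mul_eq_mul_div, ← add_div, div_eq_iff h]
  fin_cases i <;> simp [det2] <;> ring

lemma coord_inj (h : det2 e w ≠ 0) {s s' y y' : ℝ} (heq : s • e + y • w = s' • e + y' • w) :
    s = s' ∧ y = y' :=
  ⟨by simpa only [coordFst_apply h] using congrArg (coordFst e w) heq,
    by simpa only [coordSnd_apply h] using congrArg (coordSnd e w) heq⟩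

lemma exists_coord (h : det2 e w ≠ 0) (v : Plane) : ∃ s y : ℝ, v = s • e + y • w :=
  ⟨_, _, (coord_eq h v).symm⟩

end Coordinates

/-- In the basis `(e, w)`, the set `K` is the region `a ≤ s ≤ b`, `f s ≤ y ≤ g s` between the graphs
of a convex function `f` and a concave function `g`. -/
structure IsGraphBody (K : Set Plane) (e w : Plane) (a b : ℝ) (f g : ℝ → ℝ) : Prop where
  det_ne : det2 e w ≠ 0
  lt : a < b
  mem_iff : ∀ s y : ℝ, s • e + y • w ∈ K ↔ s ∈ Icc a b ∧ f s ≤ y ∧ y ≤ g s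
  convexOn : ConvexOn ℝ (Icc a b) f
  concaveOn : ConcaveOn ℝ (Icc a b) g
  continuousOn_lower : ContinuousOn f (Icc a b)
  continuousOn_upper : ContinuousOn g (Icc a b)
  le : ∀ s ∈ Icc a b, f s ≤ g s
  lower_lt_upper : ∀ s ∈ Ioo a b, f s < g s

/-- A concave function that is at least `t` at `u` and exceeds `t` at `v` exceeds `t` at every point
between them other than `u`. -/
lemma ConcaveOn.lt_of_between {h : ℝ → ℝ} {a b : ℝ} (hc : ConcaveOn ℝ (Icc a b) h) {u v s t : ℝ}
    (hu : u ∈ Icc a b) (hv : v ∈ Icc a b) (htu : t ≤ h u) (htv : t < h v)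
    (hs : u < s ∧ s ≤ v ∨ v ≤ s ∧ s < u) : t < h s := by
  have huv : v - u ≠ 0 := by
    rcases hs with hs | hs
    · exact (sub_pos.2 (hs.1.trans_le hs.2)).ne'
    · exact (sub_neg.2 (hs.1.trans_lt hs.2)).ne
  set l := (s - u) / (v - u) with hl
  have hl0 : 0 < l := by
    rcases hs with hs | hs
    · exact div_pos (by linarith) (by linarith)
    · exact div_pos_of_neg_of_neg (by linarith) (by linarith)
  have hl1 : l ≤ 1 := by
    rcases hs with hs | hs
    · exact (div_le_one (by linarith)).2 (by linarith)
    · exact (div_le_one_of_neg (by linarith)).2 (by linarith)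
  have key := hc.2 hu hv (sub_nonneg.2 hl1) hl0.le (by ring)
  have hseq : (1 - l) • u + l • v = s := by
    have : l * (v - u) = s - u := div_mul_cancel₀ _ huv
    simp only [smul_eq_mul]; linarith
  rw [hseq] at key
  simp only [smul_eq_mul] at key
  nlinarith [mul_nonneg (sub_nonneg.2 hl1) (sub_nonneg.2 htu), mul_pos hl0 (sub_pos.2 htv)]

lemma exists_pos_add_mem_of_mem_interior {K : Set Plane} {q : Plane} (hq : q ∈ interior K)
    (d : Plane) : ∃ ε : ℝ, 0 < ε ∧ q + ε • d ∈ K ∧ q - ε • d ∈ K := by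
  have hnhds : K ∈ 𝓝 q := mem_interior_iff_mem_nhds.1 hq
  have h1 : Tendsto (fun ε : ℝ => q + ε • d) (𝓝[>] 0) (𝓝 q) := by
    have : Continuous fun ε : ℝ => q + ε • d := by fun_prop
    simpa using (this.tendsto 0).mono_left (nhdsWithin_le_nhds (s := Ioi 0))
  have h2 : Tendsto (fun ε : ℝ => q - ε • d) (𝓝[>] 0) (𝓝 q) := by
    have : Continuous fun ε : ℝ => q - ε • d := by fun_prop
    simpa using (this.tendsto 0).mono_left (nhdsWithin_le_nhds (s := Ioi 0))
  obtain ⟨ε, ⟨hε1, hε2⟩, hε0⟩ :=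
    (((h1.eventually hnhds).and (h2.eventually hnhds)).and self_mem_nhdsWithin).exists
  exact ⟨ε, hε0, hε1, hε2⟩

/-- One-sided continuity at an end point of the upper boundary function of a compact convex set:
the upper semicontinuity comes from compactness, the lower one from the chord to another point. -/
lemma continuousWithinAt_upper {K : Set Plane} (hcomp : IsCompact K) {e w : Plane} {a b : ℝ}
    {f g : ℝ → ℝ} (hdet : det2 e w ≠ 0)
    (hmem : ∀ s y : ℝ, s • e + y • w ∈ K ↔ s ∈ Icc a b ∧ f s ≤ y ∧ y ≤ g s)
    (hle : ∀ s ∈ Icc a b, f s ≤ g s) (hconc : ConcaveOn ℝ (Icc a b) g) {s₀ s₁ : ℝ}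
    (h₀ : s₀ ∈ Icc a b) (h₁ : s₁ ∈ Icc a b) (hne : s₀ ≠ s₁) :
    Tendsto g (𝓝[uIcc s₀ s₁] s₀) (𝓝 (g s₀)) := by
  have hsub : uIcc s₀ s₁ ⊆ Icc a b := uIcc_subset_Icc h₀ h₁
  refine tendsto_order.2 ⟨fun c hc => ?_, fun c hc => ?_⟩
  · have hchord : Tendsto (fun s => g s₀ + (s - s₀) / (s₁ - s₀) * (g s₁ - g s₀))
        (𝓝[uIcc s₀ s₁] s₀) (𝓝 (g s₀)) := by
      have : Continuous fun s => g s₀ + (s - s₀) / (s₁ - s₀) * (g s₁ - g s₀) := by fun_prop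
      simpa using (this.tendsto s₀).mono_left (nhdsWithin_le_nhds (s := uIcc s₀ s₁))
    filter_upwards [hchord.eventually_const_lt hc, self_mem_nhdsWithin] with s hs hsmem
    refine hs.trans_le ?_
    have hne' : s₁ - s₀ ≠ 0 := sub_ne_zero.2 hne.symm
    set l := (s - s₀) / (s₁ - s₀) with hl
    have hl01 : 0 ≤ l ∧ l ≤ 1 := by
      rcases lt_or_gt_of_ne hne with h | h
      · rw [uIcc_of_le h.le] at hsmem
        exact ⟨div_nonneg (by linarith [hsmem.1]) (by linarith),
          (div_le_one (by linarith)).2 (by linarith [hsmem.2])⟩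
      · rw [uIcc_of_ge h.le] at hsmem
        exact ⟨div_nonneg_of_nonpos (by linarith [hsmem.2]) (by linarith),
          (div_le_one_of_neg (by linarith)).2 (by linarith [hsmem.1])⟩
    have key := hconc.2 h₀ h₁ (sub_nonneg.2 hl01.2) hl01.1 (by ring)
    have hseq : (1 - l) • s₀ + l • s₁ = s := by
      have : l * (s₁ - s₀) = s - s₀ := div_mul_cancel₀ _ hne'
      simp only [smul_eq_mul]; linarith
    rw [hseq] at key
    simp only [smul_eq_mul] at key
    linarith
  · set T := coordFst e w '' (K ∩ {v | c ≤ coordSnd e w v}) with hT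
    have hTc : IsClosed T := ((hcomp.inter_right
      (isClosed_le continuous_const continuous_coordSnd)).image continuous_coordFst).isClosed
    have hmemT : ∀ s ∈ Icc a b, c ≤ g s → s ∈ T := fun s hs hcs =>
      ⟨s • e + g s • w, ⟨(hmem _ _).2 ⟨hs, hle s hs, le_rfl⟩, by
        simpa only [mem_ofPred_eq, coordSnd_apply hdet] using hcs⟩, coordFst_apply hdet _ _⟩
    have hs₀ : s₀ ∉ T := by
      rintro ⟨v, ⟨hv, hcv⟩, hs⟩
      rw [← coord_eq hdet v, hs, hmem] at hv
      exact absurd (hv.2.2.trans_lt hc) (not_lt.2 hcv)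
    filter_upwards [nhdsWithin_le_nhds (hTc.isOpen_compl.mem_nhds hs₀), self_mem_nhdsWithin]
      with s hs hsmem
    exact lt_of_not_ge fun h => hs (hmemT s (hsub hsmem) h)

lemma concaveOn_upper_of_convex {K : Set Plane} (hconv : Convex ℝ K) {e w : Plane} {a b : ℝ}
    {f g : ℝ → ℝ}
    (hmem : ∀ s y : ℝ, s • e + y • w ∈ K ↔ s ∈ Icc a b ∧ f s ≤ y ∧ y ≤ g s)
    (hle : ∀ s ∈ Icc a b, f s ≤ g s) : ConcaveOn ℝ (Icc a b) g := by
  refine ⟨convex_Icc a b, fun s hs t ht l m hl hm hlm => ?_⟩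
  have := hconv ((hmem s (g s)).2 ⟨hs, hle s hs, le_rfl⟩)
    ((hmem t (g t)).2 ⟨ht, hle t ht, le_rfl⟩) hl hm hlm
  have heq : l • (s • e + g s • w) + m • (t • e + g t • w) =
      (l • s + m • t) • e + (l • g s + m • g t) • w := by
    simp only [smul_eq_mul]; module
  rw [heq, hmem] at this
  exact this.2.2

lemma continuousOn_upper_of_isCompact {K : Set Plane} (hcomp : IsCompact K) {e w : Plane} {a b : ℝ}
    {f g : ℝ → ℝ} (hdet : det2 e w ≠ 0) (hab : a < b)
    (hmem : ∀ s y : ℝ, s • e + y • w ∈ K ↔ s ∈ Icc a b ∧ f s ≤ y ∧ y ≤ g s)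
    (hle : ∀ s ∈ Icc a b, f s ≤ g s) (hconc : ConcaveOn ℝ (Icc a b) g) :
    ContinuousOn g (Icc a b) := by
  have ha := left_mem_Icc.2 hab.le
  have hb := right_mem_Icc.2 hab.le
  refine hconc.continuousOn_Icc hab ?_ ?_
  · have := continuousWithinAt_upper hcomp hdet hmem hle hconc ha hb hab.ne
    rwa [uIcc_of_le hab.le, nhdsWithin_Icc_eq_nhdsGE hab] at this
  · have := continuousWithinAt_upper hcomp hdet hmem hle hconc hb ha hab.ne'
    rwa [uIcc_of_ge hab.le, nhdsWithin_Icc_eq_nhdsLE hab] at this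

lemma exists_mem_iff_of_isCompact {K : Set Plane} (hcomp : IsCompact K) (hconv : Convex ℝ K)
    (hne : K.Nonempty) {e w : Plane} (hdet : det2 e w ≠ 0) :
    ∃ (a b : ℝ) (f g : ℝ → ℝ), (∀ s ∈ Icc a b, f s ≤ g s) ∧
      ∀ s y : ℝ, s • e + y • w ∈ K ↔ s ∈ Icc a b ∧ f s ≤ y ∧ y ≤ g s := by
  have hcoord : ∀ s y s' y' l m : ℝ, l • (s • e + y • w) + m • (s' • e + y' • w) =
      (l • s + m • s') • e + (l • y + m • y') • w := fun s y s' y' l m => by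
    simp only [smul_eq_mul]; module
  have hproj : Convex ℝ (coordFst e w '' K) := by
    rintro _ ⟨u, hu, rfl⟩ _ ⟨v, hv, rfl⟩ l m hl hm hlm
    refine ⟨l • u + m • v, hconv hu hv hl hm hlm, ?_⟩
    conv_lhs => rw [← coord_eq hdet u, ← coord_eq hdet v, hcoord]
    rw [coordFst_apply hdet]
  have hI := eq_Icc_of_connected_compact ⟨hne.image _, hproj.isPreconnected⟩
    (hcomp.image continuous_coordFst)
  have hfib : ∀ s ∈ coordFst e w '' K, {y : ℝ | s • e + y • w ∈ K} =
      Icc (sInf {y : ℝ | s • e + y • w ∈ K}) (sSup {y : ℝ | s • e + y • w ∈ K}) ∧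
      {y : ℝ | s • e + y • w ∈ K}.Nonempty := by
    rintro s ⟨u, hu, rfl⟩
    have hne' : {y : ℝ | coordFst e w u • e + y • w ∈ K}.Nonempty :=
      ⟨coordSnd e w u, by simpa only [mem_ofPred_eq, coord_eq hdet] using hu⟩
    have hconv' : Convex ℝ {y : ℝ | coordFst e w u • e + y • w ∈ K} := by
      intro y hy y' hy' l m hl hm hlm
      have := hconv hy hy' hl hm hlm
      rw [hcoord] at this
      simpa only [mem_ofPred_eq, ← add_smul, hlm, one_smul] using this
    have hcomp' : IsCompact {y : ℝ | coordFst e w u • e + y • w ∈ K} := by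
      have : {y : ℝ | coordFst e w u • e + y • w ∈ K} =
          coordSnd e w '' (K ∩ {v | coordFst e w v = coordFst e w u}) := by
        ext y
        constructor
        · intro hy
          exact ⟨_, ⟨hy, coordFst_apply hdet _ _⟩, coordSnd_apply hdet _ _⟩
        · rintro ⟨v, ⟨hv, hvu⟩, rfl⟩
          have hvu' : coordFst e w v = coordFst e w u := hvu
          rw [mem_ofPred_eq, ← hvu', coord_eq hdet]
          exact hv
      rw [this]
      exact (hcomp.inter_right (isClosed_eq continuous_coordFst continuous_const)).image
        continuous_coordSnd
    exact ⟨eq_Icc_of_connected_compact ⟨hne', hconv'.isPreconnected⟩ hcomp', hne'⟩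
  refine ⟨sInf (coordFst e w '' K), sSup (coordFst e w '' K), fun s => sInf {y : ℝ | s • e + y • w ∈ K},
    fun s => sSup {y : ℝ | s • e + y • w ∈ K}, fun s hs => ?_, fun s y => ⟨fun h => ?_, ?_⟩⟩
  · rw [← hI] at hs
    obtain ⟨h1, h2⟩ := hfib s hs
    rw [h1] at h2
    exact nonempty_Icc.1 h2
  · have hs : s ∈ coordFst e w '' K := ⟨_, h, coordFst_apply hdet _ _⟩
    rw [← hI]
    refine ⟨hs, ?_⟩
    have := (hfib s hs).1.subset h
    exact this
  · rintro ⟨hs, hy⟩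
    rw [← hI] at hs
    exact (hfib s hs).1.superset hy

/-- The fields of `IsGraphBody` that follow from the description of `K` as a set. -/
lemma IsGraphBody.of_mem_iff {K : Set Plane} (hcomp : IsCompact K) (hconv : Convex ℝ K)
    {e w : Plane} (hdet : det2 e w ≠ 0) {a b : ℝ} {f g : ℝ → ℝ}
    (hmem : ∀ s y : ℝ, s • e + y • w ∈ K ↔ s ∈ Icc a b ∧ f s ≤ y ∧ y ≤ g s)
    (hle : ∀ s ∈ Icc a b, f s ≤ g s) (hab : a < b) {s₀ : ℝ} (hs₀ : s₀ ∈ Icc a b)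
    (hlt : f s₀ < g s₀) : IsGraphBody K e w a b f g := by
  have hdet' : det2 e (-w) ≠ 0 := by rw [det2_neg_right]; exact neg_ne_zero.2 hdet
  have hmem' : ∀ s y : ℝ, s • e + y • (-w) ∈ K ↔ s ∈ Icc a b ∧ -g s ≤ y ∧ y ≤ -f s := by
    intro s y
    rw [smul_neg, ← neg_smul, hmem]
    exact and_congr_right fun _ =>
      ⟨fun h => ⟨by linarith [h.2], by linarith [h.1]⟩,
        fun h => ⟨by linarith [h.2], by linarith [h.1]⟩⟩
  have hle' : ∀ s ∈ Icc a b, -g s ≤ -f s := fun s hs => neg_le_neg (hle s hs)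
  have hconc := concaveOn_upper_of_convex hconv hmem hle
  have hconc' : ConcaveOn ℝ (Icc a b) (-f) :=
    concaveOn_upper_of_convex (f := fun s => -g s) (g := fun s => -f s) hconv hmem' hle'
  have hconvf : ConvexOn ℝ (Icc a b) f := neg_concaveOn_iff.1 hconc'
  refine ⟨hdet, hab, hmem, hconvf, hconc, ?_, continuousOn_upper_of_isCompact hcomp hdet hab hmem hle hconc,
    hle, fun s hs => ?_⟩
  · have := (continuousOn_upper_of_isCompact (f := fun s => -g s) (g := fun s => -f s) hcomp hdet' hab hmem'
      hle' hconc').neg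
    exact this.congr fun s _ => (neg_neg (f s)).symm
  · have hh : ConcaveOn ℝ (Icc a b) (g - f) := hconc.sub hconvf
    have h0 : (0 : ℝ) < (g - f) s₀ := sub_pos.2 hlt
    rcases le_total s s₀ with h | h
    · exact sub_pos.1 (hh.lt_of_between (left_mem_Icc.2 hab.le) hs₀
        (sub_nonneg.2 (hle a (left_mem_Icc.2 hab.le))) h0 (Or.inl ⟨hs.1, h⟩))
    · exact sub_pos.1 (hh.lt_of_between (right_mem_Icc.2 hab.le) hs₀
        (sub_nonneg.2 (hle b (right_mem_Icc.2 hab.le))) h0 (Or.inr ⟨h, hs.2⟩))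

lemma IsPlanarBody.exists_isGraphBody {K : Set Plane} (hK : IsPlanarBody K) {e w : Plane}
    (hdet : det2 e w ≠ 0) : ∃ (a b : ℝ) (f g : ℝ → ℝ), IsGraphBody K e w a b f g := by
  obtain ⟨c, hc⟩ := hK.interior_nonempty
  obtain ⟨a, b, f, g, hle, hmem⟩ :=
    exists_mem_iff_of_isCompact hK.isCompact hK.convex ⟨c, interior_subset hc⟩ hdet
  obtain ⟨s, y, rfl⟩ := exists_coord hdet c
  obtain ⟨ε, hε, h1, h2⟩ := exists_pos_add_mem_of_mem_interior hc e
  obtain ⟨η, hη, h3, h4⟩ := exists_pos_add_mem_of_mem_interior hc w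
  rw [show s • e + y • w + ε • e = (s + ε) • e + y • w by module, hmem] at h1
  rw [show s • e + y • w - ε • e = (s - ε) • e + y • w by module, hmem] at h2
  rw [show s • e + y • w + η • w = s • e + (y + η) • w by module, hmem] at h3
  rw [show s • e + y • w - η • w = s • e + (y - η) • w by module, hmem] at h4
  exact ⟨a, b, f, g, IsGraphBody.of_mem_iff hK.isCompact hK.convex hdet hmem hle
    (by linarith [h1.1.2, h2.1.1]) h3.1 (by linarith [h3.2.2, h4.2.1])⟩

namespace IsGraphBody

variable {K : Set Plane} {e w : Plane} {a b : ℝ} {f g : ℝ → ℝ}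

/-- Reflection of the second coordinate exchanges the two boundary functions. -/
lemma neg_snd (hG : IsGraphBody K e w a b f g) :
    IsGraphBody K e (-w) a b (fun s => -g s) (fun s => -f s) where
  det_ne := by rw [det2_neg_right]; exact neg_ne_zero.2 hG.det_ne
  lt := hG.lt
  mem_iff s y := by
    rw [smul_neg, ← neg_smul, hG.mem_iff]
    exact and_congr_right fun _ =>
      ⟨fun h => ⟨by linarith [h.2], by linarith [h.1]⟩,
        fun h => ⟨by linarith [h.2], by linarith [h.1]⟩⟩
  convexOn := hG.concaveOn.neg
  concaveOn := hG.convexOn.neg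
  continuousOn_lower := hG.continuousOn_upper.neg
  continuousOn_upper := hG.continuousOn_lower.neg
  le s hs := neg_le_neg (hG.le s hs)
  lower_lt_upper s hs := neg_lt_neg (hG.lower_lt_upper s hs)

/-- Rotation of the basis by the angle `π`. -/
lemma neg_basis (hG : IsGraphBody K e w a b f g) :
    IsGraphBody K (-e) (-w) (-b) (-a) (fun s => -g (-s)) (fun s => -f (-s)) := by
  have hneg : ∀ s, s ∈ Icc (-b) (-a) ↔ -s ∈ Icc a b := fun s => by
    constructor <;> rintro ⟨h1, h2⟩ <;> constructor <;> linarith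
  have hmaps : MapsTo (fun s : ℝ => -s) (Icc (-b) (-a)) (Icc a b) := fun s hs => (hneg s).1 hs
  have hconc : ∀ {h : ℝ → ℝ}, ConcaveOn ℝ (Icc a b) h →
      ConcaveOn ℝ (Icc (-b) (-a)) (fun s => h (-s)) := fun {h} hc => by
    refine ⟨convex_Icc _ _, fun s hs t ht l m hl hm hlm => ?_⟩
    have := hc.2 ((hneg s).1 hs) ((hneg t).1 ht) hl hm hlm
    rwa [smul_neg, smul_neg, ← neg_add] at this
  exact {
    det_ne := by rw [det2_neg_right, det2_neg_left, neg_neg]; exact hG.det_ne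
    lt := neg_lt_neg hG.lt
    mem_iff := fun s y => by
      rw [smul_neg, smul_neg, ← neg_smul, ← neg_smul, hG.mem_iff, hneg]
      exact and_congr_right fun _ =>
        ⟨fun h => ⟨by linarith [h.2], by linarith [h.1]⟩,
          fun h => ⟨by linarith [h.2], by linarith [h.1]⟩⟩
    convexOn := (hconc hG.concaveOn).neg
    concaveOn := hconc hG.convexOn.neg
    continuousOn_lower := (hG.continuousOn_upper.comp continuousOn_neg hmaps).neg
    continuousOn_upper := (hG.continuousOn_lower.comp continuousOn_neg hmaps).neg
    le := fun s hs => neg_le_neg (hG.le _ ((hneg s).1 hs))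
    lower_lt_upper := fun s hs => neg_lt_neg (hG.lower_lt_upper _
      ⟨by linarith [hs.2], by linarith [hs.1]⟩) }

/-- The width function `g - f` is concave. -/
lemma concaveOn_width (hG : IsGraphBody K e w a b f g) : ConcaveOn ℝ (Icc a b) (g - f) :=
  hG.concaveOn.sub hG.convexOn

lemma continuousOn_width (hG : IsGraphBody K e w a b f g) : ContinuousOn (g - f) (Icc a b) :=
  hG.continuousOn_upper.sub hG.continuousOn_lower

lemma mem_interior_iff (hG : IsGraphBody K e w a b f g) (s y : ℝ) :
    s • e + y • w ∈ interior K ↔ s ∈ Ioo a b ∧ f s < y ∧ y < g s := by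
  constructor
  · intro h
    obtain ⟨ε, hε, h1, h2⟩ := exists_pos_add_mem_of_mem_interior h e
    obtain ⟨η, hη, h3, h4⟩ := exists_pos_add_mem_of_mem_interior h w
    rw [show s • e + y • w + ε • e = (s + ε) • e + y • w by module, hG.mem_iff] at h1
    rw [show s • e + y • w - ε • e = (s - ε) • e + y • w by module, hG.mem_iff] at h2
    rw [show s • e + y • w + η • w = s • e + (y + η) • w by module, hG.mem_iff] at h3
    rw [show s • e + y • w - η • w = s • e + (y - η) • w by module, hG.mem_iff] at h4
    exact ⟨⟨by linarith [h2.1.1], by linarith [h1.1.2]⟩, by linarith [h4.2.1],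
      by linarith [h3.2.2]⟩
  · rintro ⟨hs, hy⟩
    set O := coordFst e w ⁻¹' Ioo a b with hO
    have hOo : IsOpen O := isOpen_Ioo.preimage continuous_coordFst
    have hmaps : MapsTo (coordFst e w) O (Icc a b) := fun v hv => Ioo_subset_Icc_self hv
    have hF : ContinuousOn (fun v => coordSnd e w v - f (coordFst e w v)) O :=
      continuous_coordSnd.continuousOn.sub
        (hG.continuousOn_lower.comp continuous_coordFst.continuousOn hmaps)
    have hF' : ContinuousOn (fun v => g (coordFst e w v) - coordSnd e w v) O :=
      (hG.continuousOn_upper.comp continuous_coordFst.continuousOn hmaps).sub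
        continuous_coordSnd.continuousOn
    have hopen := (hF.isOpen_inter_preimage hOo isOpen_Ioi (t := Ioi 0)).inter
      (hF'.isOpen_inter_preimage hOo isOpen_Ioi (t := Ioi 0))
    refine mem_interior.2 ⟨_, ?_, hopen, ?_⟩
    · rintro v ⟨⟨hv, hv1⟩, -, hv2⟩
      rw [← coord_eq hG.det_ne v, hG.mem_iff]
      exact ⟨hmaps hv, (sub_pos.1 hv1).le, (sub_pos.1 hv2).le⟩
    · simp only [hO, mem_inter_iff, mem_preimage, coordFst_apply hG.det_ne,
        coordSnd_apply hG.det_ne, mem_Ioi, sub_pos]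
      exact ⟨⟨hs, hy.1⟩, hs, hy.2⟩

lemma mem_frontier_iff (hG : IsGraphBody K e w a b f g) (hK : IsClosed K) (s y : ℝ) :
    s • e + y • w ∈ frontier K ↔ (s ∈ Icc a b ∧ f s ≤ y ∧ y ≤ g s) ∧
      (s = a ∨ s = b ∨ y = f s ∨ y = g s) := by
  rw [hK.frontier_eq, Set.mem_sdiff, hG.mem_iff, hG.mem_interior_iff]
  refine and_congr_right fun ⟨hs, hy1, hy2⟩ => ⟨fun h => ?_, fun h h' => ?_⟩
  · by_contra! hc
    exact h ⟨⟨lt_of_le_of_ne hs.1 (Ne.symm hc.1), lt_of_le_of_ne hs.2 hc.2.1⟩,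
      lt_of_le_of_ne hy1 (Ne.symm hc.2.2.1), lt_of_le_of_ne hy2 hc.2.2.2⟩
  · rcases h with h | h | h | h
    exacts [h'.1.1.ne' h, h'.1.2.ne h, h'.2.1.ne' h, h'.2.2.ne h]

lemma arcLen_upper_ne_top (hG : IsGraphBody K e w a b f g) (p : Seminorm ℝ Plane) :
    arcLen p (fun s => s • e + g s • w) (Icc a b) ≠ ∞ := by
  obtain ⟨m, hm, hmax⟩ := isCompact_Icc.exists_isMaxOn (nonempty_Icc.2 hG.lt.le)
    hG.continuousOn_upper
  have hbound : ∀ s t : ℝ, s ≤ t → p ((t • e + g t • w) - (s • e + g s • w)) ≤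
      (t - s) * p e + |g t - g s| * p w := fun s t hst => by
    rw [show (t • e + g t • w) - (s • e + g s • w) = (t - s) • e + (g t - g s) • w by module]
    refine (map_add_le_add p _ _).trans_eq ?_
    rw [map_smul_eq_mul, map_smul_eq_mul, Real.norm_of_nonneg (sub_nonneg.2 hst),
      Real.norm_eq_abs]
  have hmin : ∀ u ∈ Icc a b, ∀ v ∈ Icc a b, ∀ s ∈ Icc u v, min (g u) (g v) ≤ g s :=
    fun u hu v hv s hs => hG.concaveOn.ge_on_segment hu hv
      (by rw [segment_eq_Icc (hs.1.trans hs.2)]; exact hs)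
  rw [← arcLen_add p _ hm.1 hm.2]
  refine ENNReal.add_ne_top.2 ⟨ne_top_of_le_ne_top ENNReal.ofReal_ne_top
    (arcLen_le_of_le_sub (F := fun s => s * p e + g s * p w) hm.1 fun s hs t ht hst => ?_),
    ne_top_of_le_ne_top ENNReal.ofReal_ne_top
    (arcLen_le_of_le_sub (F := fun s => s * p e - g s * p w) hm.2 fun s hs t ht hst => ?_)⟩
  · have hsm : g s ≤ g m := hmax ⟨hs.1, hs.2.trans hm.2⟩
    have := hmin s ⟨hs.1, hs.2.trans hm.2⟩ m hm t ⟨hst, ht.2⟩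
    rw [min_eq_left hsm] at this
    refine (hbound s t hst).trans_eq ?_
    rw [abs_of_nonneg (sub_nonneg.2 this)]; ring
  · have htm : g t ≤ g m := hmax ⟨hm.1.trans ht.1, ht.2⟩
    have := hmin m hm t ⟨hm.1.trans ht.1, ht.2⟩ s ⟨hs.1, hst⟩
    rw [min_eq_right htm] at this
    refine (hbound s t hst).trans_eq ?_
    rw [abs_of_nonpos (sub_nonpos.2 this)]; ring

lemma arcLen_lower_ne_top (hG : IsGraphBody K e w a b f g) (p : Seminorm ℝ Plane) :
    arcLen p (fun s => s • e + f s • w) (Icc a b) ≠ ∞ := by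
  have := hG.neg_snd.arcLen_upper_ne_top p
  simpa using this

/-- The two graphs and the two edges parallel to `w`, written as `X k s • e + Z k s • w`, meet only at
their end points. -/
lemma pairwise_disjoint_boundary_pieces (hG : IsGraphBody K e w a b f g) {X Z : Fin 4 → ℝ → ℝ}
    (hX : X = ![fun s => s, fun s => s, fun _ => a, fun _ => b])
    (hZ : Z = ![g, f, fun s => s, fun s => s]) :
    Pairwise fun k l : Fin 4 =>
      Disjoint ((fun s => X k s • e + Z k s • w) ''
          Ioo ((![a, a, f a, f b] : Fin 4 → ℝ) k) ((![b, b, g a, g b] : Fin 4 → ℝ) k))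
        ((fun s => X l s • e + Z l s • w) ''
          Ioo ((![a, a, f a, f b] : Fin 4 → ℝ) l) ((![b, b, g a, g b] : Fin 4 → ℝ) l)) := by
  intro k l hkl
  refine disjoint_image_image fun s hs t ht h => ?_
  obtain ⟨h1, h2⟩ := coord_inj hG.det_ne h
  have h3 := hG.lt
  subst hX hZ
  fin_cases k <;> fin_cases l <;> simp at hkl hs ht h1 h2
  · subst h1; linarith [hG.lower_lt_upper s hs]
  · linarith
  · linarith
  · subst h1; linarith [hG.lower_lt_upper s hs]
  · linarith
  · linarith
  · linarith
  · linarith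
  · linarith
  · linarith
  · linarith
  · linarith

/-- The perimeter of a body between two graphs: the lengths of the graphs and of the two (possibly
degenerate) edges parallel to `w`. -/
theorem perB_eq (hG : IsGraphBody K e w a b f g) (hcomp : IsCompact K) (hconv : Convex ℝ K)
    {B : Set Plane} {p : Seminorm ℝ Plane} (hp : Continuous p) (hpB : ∀ v, p v = gauge B v) :
    perB B K = (arcLen p (fun s => s • e + g s • w) (Icc a b)).toReal +
      (arcLen p (fun s => s • e + f s • w) (Icc a b)).toReal +
      (g a - f a) * p w + (g b - f b) * p w := by
  have hab := hG.lt
  have ha := left_mem_Icc.2 hab.le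
  have hb := right_mem_Icc.2 hab.le
  have hint : (interior K).Nonempty := by
    have hmid : (a + b) / 2 ∈ Ioo a b := ⟨by linarith, by linarith⟩
    have := hG.lower_lt_upper _ hmid
    exact ⟨((a + b) / 2) • e + ((f ((a + b) / 2) + g ((a + b) / 2)) / 2) • w,
      (hG.mem_interior_iff _ _).2 ⟨hmid, by linarith, by linarith⟩⟩
  rw [perB, if_pos hint]
  set X : Fin 4 → ℝ → ℝ := ![fun s => s, fun s => s, fun _ => a, fun _ => b] with hX
  set Z : Fin 4 → ℝ → ℝ := ![g, f, fun s => s, fun s => s] with hZ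
  have hcontXZ : ∀ i, ContinuousOn (X i) (Icc ((![a, a, f a, f b] : Fin 4 → ℝ) i)
      ((![b, b, g a, g b] : Fin 4 → ℝ) i)) ∧ ContinuousOn (Z i) (Icc
      ((![a, a, f a, f b] : Fin 4 → ℝ) i) ((![b, b, g a, g b] : Fin 4 → ℝ) i)) := by
    intro i
    fin_cases i <;> simp [X, Z]
    exacts [⟨continuousOn_id, hG.continuousOn_upper⟩, ⟨continuousOn_id, hG.continuousOn_lower⟩,
      ⟨continuousOn_const, continuousOn_id⟩, ⟨continuousOn_const, continuousOn_id⟩]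
  rw [lenB_eq_sum_arcLen hp hpB (ι := Fin 4) (γ := fun i s => X i s • e + Z i s • w)
    (a := ![a, a, f a, f b]) (b := ![b, b, g a, g b])
    (exists_isSimpleParam_frontier hconv hint hcomp.isBounded)]
  · have h1 := hG.arcLen_upper_ne_top p
    have h2 := hG.arcLen_lower_ne_top p
    rw [Fin.sum_univ_four]
    simp only [X, Z, Matrix.cons_val_zero, Matrix.cons_val_one, Matrix.cons_val]
    rw [arcLen_line _ _ (hG.le a ha), arcLen_line _ _ (hG.le b hb),
      ENNReal.toReal_add (by finiteness) (by finiteness),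
      ENNReal.toReal_add (by finiteness) (by finiteness),
      ENNReal.toReal_add (by finiteness) (by finiteness), ENNReal.toReal_ofReal,
      ENNReal.toReal_ofReal]
    exacts [mul_nonneg (sub_nonneg.2 (hG.le b hb)) (apply_nonneg p w),
      mul_nonneg (sub_nonneg.2 (hG.le a ha)) (apply_nonneg p w)]
  · intro i
    fin_cases i
    exacts [hab.le, hab.le, hG.le a ha, hG.le b hb]
  · exact fun i => ((hcontXZ i).1.smul continuousOn_const).add
      ((hcontXZ i).2.smul continuousOn_const)
  · intro i s _ t _ h
    obtain ⟨h1, h2⟩ := coord_inj hG.det_ne h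
    fin_cases i
    exacts [h1, h1, h2, h2]
  · exact hG.pairwise_disjoint_boundary_pieces hX hZ
  · ext v
    obtain ⟨s, y, rfl⟩ := exists_coord hG.det_ne v
    rw [hG.mem_frontier_iff hcomp.isClosed, mem_iUnion]
    constructor
    · rintro ⟨⟨hs, hy⟩, rfl | rfl | rfl | rfl⟩
      exacts [⟨2, y, hy, rfl⟩, ⟨3, y, hy, rfl⟩, ⟨1, s, hs, rfl⟩, ⟨0, s, hs, rfl⟩]
    · rintro ⟨i, t, ht, h⟩
      obtain ⟨h1, h2⟩ := coord_inj hG.det_ne h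
      fin_cases i <;> simp [X, Z] at ht h1 h2 <;> subst h1 h2
      · exact ⟨⟨ht, hG.le _ ht, le_rfl⟩, by simp⟩
      · exact ⟨⟨ht, le_rfl, hG.le _ ht⟩, by simp⟩
      · exact ⟨⟨ha, ht⟩, by simp⟩
      · exact ⟨⟨hb, ht⟩, by simp⟩

end IsGraphBody

/-! ### One-sided tangents -/

lemma det2_coord (e w : Plane) (s y s' y' : ℝ) :
    det2 (s • e + y • w) (s' • e + y' • w) = det2 e w * (s * y' - y * s') := by
  simp [det2]; ring

lemma coord_sub (e w : Plane) (s y s' y' : ℝ) :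
    (s • e + y • w) - (s' • e + y' • w) = (s - s') • e + (y - y') • w := by
  module

lemma add_smul_ne_zero_of_det2 {e w : Plane} (h : det2 e w ≠ 0) (m : ℝ) : e + m • w ≠ 0 := by
  intro h0
  have := coord_inj h (s := 1) (y := m) (s' := 0) (y' := 0) (by simpa using h0)
  exact one_ne_zero this.1

lemma ConcaveOn.three_point {g : ℝ → ℝ} {a b : ℝ} (hc : ConcaveOn ℝ (Icc a b) g) {u v z : ℝ}
    (hu : u ∈ Icc a b) (hz : z ∈ Icc a b) (huv : u ≤ v) (hvz : v ≤ z) :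
    g u * (z - v) + g z * (v - u) ≤ g v * (z - u) := by
  rcases (huv.trans hvz).eq_or_lt with h | h
  · have h1 : v = u := le_antisymm (h ▸ hvz) huv
    subst h1 h; simp
  · have hpos : 0 < z - u := sub_pos.2 h
    have key := hc.2 hu hz (div_nonneg (sub_nonneg.2 hvz) hpos.le)
      (div_nonneg (sub_nonneg.2 huv) hpos.le) (by rw [← add_div, div_eq_one_iff_eq hpos.ne']; ring)
    have hv : ((z - v) / (z - u)) • u + ((v - u) / (z - u)) • z = v := by
      simp only [smul_eq_mul]; field_simp; ring
    rw [hv] at key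
    simp only [smul_eq_mul] at key
    calc g u * (z - v) + g z * (v - u)
        = ((z - v) / (z - u) * g u + (v - u) / (z - u) * g z) * (z - u) := by field_simp
      _ ≤ g v * (z - u) := mul_le_mul_of_nonneg_right key hpos.le

namespace IsGraphBody

variable {K : Set Plane} {e w : Plane} {a b : ℝ} {f g : ℝ → ℝ}

/-- A point of the upper graph that is seen from the interior point `c` on the counterclockwise side of
the point at `s₁` (for a positively oriented basis) lies at `s < s₁`, as long as it is not beyond `c`. -/
lemma lt_of_det2_pos (hG : IsGraphBody K e w a b f g) {s₁ c₁ c₂ s : ℝ} (hs₁ : s₁ ∈ Ioo a b)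
    (hc : c₁ • e + c₂ • w ∈ interior K) (hs : s ∈ Icc a b) (hsc : s₁ < c₁ → s < c₁)
    (hpos : 0 < det2 e w * det2 ((s₁ • e + g s₁ • w) - (c₁ • e + c₂ • w))
      ((s • e + g s • w) - (c₁ • e + c₂ • w))) : s < s₁ := by
  obtain ⟨hc₁, -, hc₂⟩ := (hG.mem_interior_iff _ _).1 hc
  by_contra! hle
  rw [coord_sub, coord_sub, det2_coord, ← mul_assoc] at hpos
  have hpos' := (pos_iff_pos_of_mul_pos hpos).1 (mul_self_pos.2 hG.det_ne)
  rcases le_or_gt c₁ s₁ with h | h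
  · have := hG.concaveOn.three_point (Ioo_subset_Icc_self hc₁) hs h hle
    nlinarith [mul_nonneg (sub_nonneg.2 hc₂.le) (sub_nonneg.2 hle)]
  · have := hG.concaveOn.three_point (Ioo_subset_Icc_self hs₁) (Ioo_subset_Icc_self hc₁) hle
      (hsc h).le
    nlinarith [mul_nonneg (sub_nonneg.2 hc₂.le) (sub_nonneg.2 hle)]

/-- Near a point of the upper graph, the boundary points on the side `s < s₁` are recognized by the
sign of a determinant, for every choice of the centre `c`; their secants converge to the left
derivative of `g`. -/
lemma tendsto_secant (hG : IsGraphBody K e w a b f g) (hK : IsClosed K) {s₁ m : ℝ}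
    (hs₁ : s₁ ∈ Ioo a b) (hm : HasDerivWithinAt g m (Iio s₁) s₁) {c : Plane}
    (hc : c ∈ interior K) :
    Tendsto (fun y => ‖y - (s₁ • e + g s₁ • w)‖⁻¹ • (y - (s₁ • e + g s₁ • w)))
      (𝓝[{y | y ∈ frontier K ∧ 0 < det2 e w * det2 ((s₁ • e + g s₁ • w) - c) (y - c)}]
        (s₁ • e + g s₁ • w)) (𝓝 (-(‖e + m • w‖⁻¹ • (e + m • w)))) := by
  set q := s₁ • e + g s₁ • w with hq
  set l := 𝓝[{y | y ∈ frontier K ∧ 0 < det2 e w * det2 (q - c) (y - c)}] q with hl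
  have hS : Tendsto (coordFst e w) l (𝓝 s₁) := by
    have := continuous_coordFst (e := e) (w := w) |>.tendsto q
    rw [hq, coordFst_apply hG.det_ne] at this
    exact this.mono_left nhdsWithin_le_nhds
  have hY : Tendsto (coordSnd e w) l (𝓝 (g s₁)) := by
    have := continuous_coordSnd (e := e) (w := w) |>.tendsto q
    rw [hq, coordSnd_apply hG.det_ne] at this
    exact this.mono_left nhdsWithin_le_nhds
  have hf : Tendsto (fun y => f (coordFst e w y)) l (𝓝 (f s₁)) :=
    (hG.continuousOn_lower.continuousAt (Icc_mem_nhds hs₁.1 hs₁.2)).tendsto.comp hS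
  obtain ⟨c₁, c₂, rfl⟩ := exists_coord hG.det_ne c
  have hev : ∀ᶠ y in l, coordFst e w y < s₁ ∧
      y = coordFst e w y • e + g (coordFst e w y) • w := by
    have hcside : ∀ᶠ y in l, s₁ < c₁ → coordFst e w y < c₁ := by
      by_cases h : s₁ < c₁
      · exact (hS.eventually_lt_const h).mono fun y hy _ => hy
      · exact Eventually.of_forall fun y hy => absurd hy h
    filter_upwards [self_mem_nhdsWithin, hS.eventually (Ioo_mem_nhds hs₁.1 hs₁.2),
      hf.eventually_lt hY (hG.lower_lt_upper s₁ hs₁), hcside] with y hy hyI hlt hside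
    obtain ⟨hfr, hdet⟩ := hy
    rw [← coord_eq hG.det_ne y, hG.mem_frontier_iff hK] at hfr
    have hyg : coordSnd e w y = g (coordFst e w y) := by
      rcases hfr.2 with h | h | h | h
      exacts [absurd h hyI.1.ne', absurd h hyI.2.ne, absurd h hlt.ne', h]
    have hy' : y = coordFst e w y • e + g (coordFst e w y) • w := by
      rw [← hyg, coord_eq hG.det_ne]
    refine ⟨?_, hy'⟩
    rw [hy'] at hdet
    exact hG.lt_of_det2_pos hs₁ hc (Ioo_subset_Icc_self hyI) hside hdet
  have hS' : Tendsto (coordFst e w) l (𝓝[<] s₁) :=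
    tendsto_nhdsWithin_iff.2 ⟨hS, hev.mono fun y hy => hy.1⟩
  have hslope := ((hasDerivWithinAt_iff_tendsto_slope' self_notMem_Iio).1 hm).comp hS'
  have hv : Tendsto (fun y => e + slope g s₁ (coordFst e w y) • w) l (𝓝 (e + m • w)) :=
    tendsto_const_nhds.add (hslope.smul_const w)
  have hlim := ((hv.norm.inv₀ (norm_ne_zero_iff.2
    (add_smul_ne_zero_of_det2 hG.det_ne m))).smul hv).neg
  refine hlim.congr' (hev.mono fun y hy => ?_)
  obtain ⟨hlt, hyeq⟩ := hy
  set s := coordFst e w y with hs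
  have hneg : s - s₁ < 0 := sub_neg.2 hlt
  have hyq : y - q = (s - s₁) • (e + slope g s₁ s • w) := by
    rw [hyeq, hq, coord_sub, slope_def_field, smul_add, smul_smul,
      mul_div_cancel₀ _ hneg.ne]
  beta_reduce
  rw [hyq, norm_smul, Real.norm_of_nonpos hneg.le, smul_smul, mul_inv, ← neg_smul]
  rw [inv_neg, neg_mul, neg_mul, mul_right_comm, inv_mul_cancel₀ hneg.ne, one_mul]

/-- The limit in `tendsto_secant` is not vacuous, here for a centre `c` on the chord at `s₁`. -/
lemma neBot_nhdsWithin_side (hG : IsGraphBody K e w a b f g) (hK : IsClosed K) {s₁ y₀ : ℝ}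
    (hs₁ : s₁ ∈ Ioo a b) (hy₀ : y₀ < g s₁) :
    (𝓝[{y | y ∈ frontier K ∧ 0 < det2 e w * det2 ((s₁ • e + g s₁ • w) - (s₁ • e + y₀ • w))
      (y - (s₁ • e + y₀ • w))}] (s₁ • e + g s₁ • w)).NeBot := by
  have hT : Tendsto (fun s => s • e + g s • w) (𝓝[<] s₁) (𝓝[{y | y ∈ frontier K ∧
      0 < det2 e w * det2 ((s₁ • e + g s₁ • w) - (s₁ • e + y₀ • w)) (y - (s₁ • e + y₀ • w))}]
        (s₁ • e + g s₁ • w)) := by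
    refine tendsto_nhdsWithin_iff.2 ⟨?_, ?_⟩
    · have hg := (hG.continuousOn_upper.continuousAt (Icc_mem_nhds hs₁.1 hs₁.2)).tendsto
      exact ((tendsto_id.smul_const e).add (hg.smul_const w)).mono_left nhdsWithin_le_nhds
    · filter_upwards [Ioo_mem_nhdsLT hs₁.1] with s hs
      have hsI : s ∈ Icc a b := ⟨hs.1.le, (hs.2.trans hs₁.2).le⟩
      refine ⟨(hG.mem_frontier_iff hK _ _).2 ⟨⟨hsI, hG.le s hsI, le_rfl⟩, by simp⟩, ?_⟩
      rw [coord_sub, coord_sub, det2_coord, ← mul_assoc]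
      refine mul_pos (mul_self_pos.2 hG.det_ne) ?_
      nlinarith [mul_pos (sub_pos.2 hy₀) (sub_pos.2 hs.2)]
  exact hT.neBot

lemma mid_mem_interior (hG : IsGraphBody K e w a b f g) {s : ℝ} (hs : s ∈ Ioo a b) :
    s • e + ((f s + g s) / 2) • w ∈ interior K := by
  have := hG.lower_lt_upper s hs
  exact (hG.mem_interior_iff _ _).2 ⟨hs, by linarith, by linarith⟩

lemma mem_rightTangent_iff (hG : IsGraphBody K e w a b f g) (hK : IsClosed K)
    (hdet : 0 < det2 e w) {s₁ m : ℝ} (hs₁ : s₁ ∈ Ioo a b)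
    (hm : HasDerivWithinAt g m (Iio s₁) s₁) (q : Plane) :
    q ∈ rightTangent K (s₁ • e + g s₁ • w) ↔
      ∃ r : ℝ, q = (s₁ • e + g s₁ • w) - r • (e + m • w) := by
  have hne := add_smul_ne_zero_of_det2 hG.det_ne m
  have hlim : IsRightTangentDir K (s₁ • e + g s₁ • w) (-(‖e + m • w‖⁻¹ • (e + m • w))) := by
    intro c hc
    have := hG.tendsto_secant hK hs₁ hm hc
    simpa only [mul_pos_iff_of_pos_left hdet] using this
  constructor
  · rintro ⟨u, hu, r, rfl⟩
    have hc := hG.mid_mem_interior hs₁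
    have hlt := hG.lower_lt_upper s₁ hs₁
    have hbot := hG.neBot_nhdsWithin_side hK hs₁ (y₀ := (f s₁ + g s₁) / 2) (by linarith)
    simp only [mul_pos_iff_of_pos_left hdet] at hbot
    rw [tendsto_nhds_unique (hu _ hc) (hlim _ hc)]
    exact ⟨r * ‖e + m • w‖⁻¹, by module⟩
  · rintro ⟨r, rfl⟩
    refine ⟨_, hlim, r * ‖e + m • w‖, ?_⟩
    rw [smul_neg, smul_smul, mul_assoc, mul_inv_cancel₀ (norm_ne_zero_iff.2 hne), mul_one,
      sub_eq_add_neg]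

lemma mem_leftTangent_iff (hG : IsGraphBody K e w a b f g) (hK : IsClosed K)
    (hdet : 0 < det2 e w) {s₁ m : ℝ} (hs₁ : s₁ ∈ Ioo a b)
    (hm : HasDerivWithinAt f m (Iio s₁) s₁) (q : Plane) :
    q ∈ leftTangent K (s₁ • e + f s₁ • w) ↔
      ∃ r : ℝ, q = (s₁ • e + f s₁ • w) - r • (e + m • w) := by
  have hG' := hG.neg_snd
  have hne := add_smul_ne_zero_of_det2 hG.det_ne m
  have hsign : ∀ d : ℝ, 0 < -det2 e w * d ↔ d < 0 := fun d => by
    rw [neg_mul, neg_pos]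
    exact ⟨fun h => lt_of_not_ge fun hd => absurd h (not_lt.2 (mul_nonneg hdet.le hd)),
      fun h => mul_neg_of_pos_of_neg hdet h⟩
  have hlim : IsLeftTangentDir K (s₁ • e + f s₁ • w) (-(‖e + m • w‖⁻¹ • (e + m • w))) := by
    intro c hc
    have := hG'.tendsto_secant hK hs₁ (m := -m) hm.neg hc
    simpa only [smul_neg, neg_smul, neg_neg, det2_neg_right, hsign] using this
  constructor
  · rintro ⟨u, hu, r, rfl⟩
    have hc := hG.mid_mem_interior hs₁
    have hlt := hG.lower_lt_upper s₁ hs₁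
    have hbot := hG'.neBot_nhdsWithin_side hK hs₁ (y₀ := -((f s₁ + g s₁) / 2)) (by linarith)
    simp only [smul_neg, neg_smul, neg_neg, det2_neg_right, hsign] at hbot
    rw [tendsto_nhds_unique (hu _ hc) (hlim _ hc)]
    exact ⟨r * ‖e + m • w‖⁻¹, by module⟩
  · rintro ⟨r, rfl⟩
    refine ⟨_, hlim, r * ‖e + m • w‖, ?_⟩
    rw [smul_neg, smul_smul, mul_assoc, mul_inv_cancel₀ (norm_ne_zero_iff.2 hne), mul_one,
      sub_eq_add_neg]

end IsGraphBody

/-! ### Boundary arcs -/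

lemma det2_cos_sin (α β : ℝ) :
    det2 !₂[Real.cos α, Real.sin α] !₂[Real.cos β, Real.sin β] = Real.sin (β - α) := by
  simp [det2, Real.sin_sub]; ring

lemma exists_angle_of_det2_pos {u v : Plane} {r α : ℝ} (hr : 0 < r)
    (hu : u = r • !₂[Real.cos α, Real.sin α]) (h : 0 < det2 u v) :
    ∃ r' β : ℝ, 0 < r' ∧ α ≤ β ∧ β < α + Real.pi ∧ v = r' • !₂[Real.cos β, Real.sin β] := by
  have hv : v ≠ 0 := by rintro rfl; simp [det2] at h
  obtain ⟨r', ψ, hr', hv'⟩ := exists_angle_of_ne_zero hv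
  set β := toIcoMod Real.two_pi_pos α ψ with hβ
  have hmem := toIcoMod_mem_Ico Real.two_pi_pos α ψ
  have hv'' : v = r' • !₂[Real.cos β, Real.sin β] := by
    rw [hv', hβ, toIcoMod, zsmul_eq_mul, Real.cos_sub_int_mul_two_pi, Real.sin_sub_int_mul_two_pi]
  refine ⟨r', β, hr', hmem.1, ?_, hv''⟩
  by_contra! hge
  rw [hu, hv'', det2_smul_left, det2_smul_right, det2_cos_sin] at h
  have hs : Real.sin (β - α) = -Real.sin (β - α - Real.pi) := by rw [Real.sin_sub_pi, neg_neg]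
  have h0 : 0 ≤ Real.sin (β - α - Real.pi) :=
    Real.sin_nonneg_of_nonneg_of_le_pi (by linarith) (by linarith [hmem.2])
  rw [hs] at h
  nlinarith [mul_pos hr hr', mul_nonneg hr.le (mul_nonneg hr'.le h0)]

lemma exists_angle_of_det2_pos_or_eq {u v : Plane} {r α : ℝ} (hr : 0 < r)
    (hu : u = r • !₂[Real.cos α, Real.sin α]) (h : 0 < det2 u v ∨ v = u) :
    ∃ r' β : ℝ, 0 < r' ∧ α ≤ β ∧ β < α + Real.pi ∧ v = r' • !₂[Real.cos β, Real.sin β] := by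
  rcases h with h | rfl
  · exact exists_angle_of_det2_pos hr hu h
  · exact ⟨r, α, hr, le_rfl, by linarith [Real.pi_pos], hu⟩

/-- Consecutive counterclockwise turns by angles in `[0, π)` around `c` put `y` on the arc from `p` to
`q`: the total angle is then less than `2π`. -/
lemma mem_bdArc_of_det2 {K : Set Plane} {p q y c : Plane} (hy : y ∈ frontier K)
    (hc : c ∈ interior K) (hpc : p ≠ c) (h1 : 0 < det2 (p - c) (y - c) ∨ y = p)
    (h2 : 0 < det2 (y - c) (q - c) ∨ q = y) : y ∈ bdArc K p q := by
  obtain ⟨r₁, α, hr₁, hα⟩ := exists_angle_of_ne_zero (sub_ne_zero.2 hpc)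
  obtain ⟨r₂, θ, hr₂, hθ1, hθ2, hθ⟩ :=
    exists_angle_of_det2_pos_or_eq hr₁ hα (v := y - c) (h1.imp id fun h => by rw [h])
  obtain ⟨r₃, β, hr₃, hβ1, hβ2, hβ⟩ :=
    exists_angle_of_det2_pos_or_eq hr₂ hθ (v := q - c) (h2.imp id fun h => by rw [h])
  exact ⟨hy, c, hc, α, θ, β, r₁, r₂, r₃, hθ1, hβ1, by linarith, hr₁, hr₂, hr₃,
    by rw [polarPt, ← hα, add_sub_cancel], by rw [polarPt, ← hθ, add_sub_cancel],
    by rw [polarPt, ← hβ, add_sub_cancel]⟩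

/-- If an arc subtends an angle less than `π` from every interior point, then the centre from which a
point of the arc is seen between the end points puts that point in the convex cone they span. -/
lemma det2_nonneg_of_mem_bdArc {K : Set Plane} {p q y : Plane} (hy : y ∈ bdArc K p q)
    (hpos : ∀ c ∈ interior K, 0 < det2 (p - c) (q - c)) :
    ∃ c ∈ interior K, 0 ≤ det2 (p - c) (y - c) ∧ 0 ≤ det2 (y - c) (q - c) := by
  obtain ⟨-, c, hc, α, θ, β, r₁, r₂, r₃, hαθ, hθβ, hβα, hr₁, hr₂, hr₃, rfl, rfl, rfl⟩ := hy
  have h := hpos c hc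
  refine ⟨c, hc, ?_⟩
  simp only [polarPt, add_sub_cancel_left, det2_smul_left, det2_smul_right, det2_cos_sin] at h ⊢
  have hlt : β - α < Real.pi := by
    by_contra! hge
    have hs : Real.sin (β - α) = -Real.sin (β - α - Real.pi) := by rw [Real.sin_sub_pi, neg_neg]
    have h0 : 0 ≤ Real.sin (β - α - Real.pi) :=
      Real.sin_nonneg_of_nonneg_of_le_pi (by linarith) (by linarith)
    rw [hs] at h
    nlinarith [mul_nonneg hr₁.le (mul_nonneg hr₃.le h0)]
  have h1 : 0 ≤ Real.sin (θ - α) :=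
    Real.sin_nonneg_of_nonneg_of_le_pi (by linarith) (by linarith)
  have h2 : 0 ≤ Real.sin (β - θ) :=
    Real.sin_nonneg_of_nonneg_of_le_pi (by linarith) (by linarith)
  exact ⟨by positivity, by positivity⟩

lemma mem_segment_coord_iff {e w : Plane} (hdet : det2 e w ≠ 0) {s₀ y₁ y₂ s y : ℝ} (h : y₂ ≤ y₁) :
    s • e + y • w ∈ segment ℝ (s₀ • e + y₁ • w) (s₀ • e + y₂ • w) ↔ s = s₀ ∧ y ∈ Icc y₂ y₁ := by
  rw [← segment_eq_Icc h, segment_symm ℝ y₂ y₁]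
  constructor
  · rintro ⟨l, m, hl, hm, hlm, heq⟩
    rw [show l • (s₀ • e + y₁ • w) + m • (s₀ • e + y₂ • w) =
      ((l + m) * s₀) • e + (l * y₁ + m * y₂) • w by module, hlm, one_mul] at heq
    obtain ⟨h1, h2⟩ := coord_inj hdet heq
    exact ⟨h1.symm, l, m, hl, hm, hlm, h2⟩
  · rintro ⟨rfl, l, m, hl, hm, hlm, rfl⟩
    refine ⟨l, m, hl, hm, hlm, ?_⟩
    rw [show l • (s • e + y₁ • w) + m • (s • e + y₂ • w) =
      ((l + m) * s) • e + (l • y₁ + m • y₂) • w by simp only [smul_eq_mul]; module, hlm, one_mul]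

namespace IsGraphBody

variable {K : Set Plane} {e w : Plane} {a b : ℝ} {f g : ℝ → ℝ}

/-- The boundary arc between two points of the edge `s = a` is a segment. -/
lemma bdArc_eq_segment (hG : IsGraphBody K e w a b f g) (hK : IsClosed K) (hdet : 0 < det2 e w)
    {y₁ y₂ : ℝ} (hlt : y₂ < y₁) (h1 : y₁ ≤ g a) (h2 : f a ≤ y₂) :
    bdArc K (a • e + y₁ • w) (a • e + y₂ • w) =
      segment ℝ (a • e + y₁ • w) (a • e + y₂ • w) := by
  have ha := left_mem_Icc.2 hG.lt.le
  ext y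
  obtain ⟨s, t, rfl⟩ := exists_coord hG.det_ne y
  rw [mem_segment_coord_iff hG.det_ne hlt.le]
  constructor
  · intro hy
    obtain ⟨⟨hs, ht1, ht2⟩, hfr⟩ := (hG.mem_frontier_iff hK _ _).1 hy.1
    obtain ⟨c, hc, hd1, hd2⟩ := det2_nonneg_of_mem_bdArc hy fun c hc => by
      obtain ⟨c₁, c₂, rfl⟩ := exists_coord hG.det_ne c
      have hc₁ := ((hG.mem_interior_iff _ _).1 hc).1.1
      rw [coord_sub, coord_sub, det2_coord]
      refine mul_pos hdet ?_
      nlinarith [mul_pos (sub_pos.2 hc₁) (sub_pos.2 hlt)]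
    obtain ⟨c₁, c₂, rfl⟩ := exists_coord hG.det_ne c
    obtain ⟨hc₁, hc₂, hc₃⟩ := (hG.mem_interior_iff _ _).1 hc
    rw [coord_sub, coord_sub, det2_coord, mul_nonneg_iff_of_pos_left hdet] at hd1 hd2
    -- `y - c` is the combination of the two end points, seen from `c`, with coefficients `l`, `m`
    have hd0 : 0 < (c₁ - a) * (y₁ - y₂) := mul_pos (sub_pos.2 hc₁.1) (sub_pos.2 hlt)
    obtain ⟨m, hm0, hm⟩ : ∃ m : ℝ, 0 ≤ m ∧ m * ((c₁ - a) * (y₁ - y₂)) =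
        (a - c₁) * (t - c₂) - (y₁ - c₂) * (s - c₁) :=
      ⟨_, div_nonneg hd1 hd0.le, div_mul_cancel₀ _ hd0.ne'⟩
    obtain ⟨l, hl0, hl⟩ : ∃ l : ℝ, 0 ≤ l ∧ l * ((c₁ - a) * (y₁ - y₂)) =
        (s - c₁) * (y₂ - c₂) - (t - c₂) * (a - c₁) :=
      ⟨_, div_nonneg hd2 hd0.le, div_mul_cancel₀ _ hd0.ne'⟩
    have hseq : s = (1 - (l + m)) * c₁ + (l + m) * a := by
      apply mul_left_cancel₀ hd0.ne'
      linear_combination (c₁ - a) * (hl + hm)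
    have hteq : t = (1 - (l + m)) * c₂ + (l * y₁ + m * y₂) := by
      apply mul_left_cancel₀ hd0.ne'
      linear_combination (c₂ - y₁) * hl + (c₂ - y₂) * hm
    have hk1 : l + m ≤ 1 := by
      by_contra! hk
      nlinarith [mul_pos (sub_pos.2 hk) (sub_pos.2 hc₁.1), hs.1]
    have hconc := hG.concaveOn.2 (Ioo_subset_Icc_self hc₁) ha (sub_nonneg.2 hk1)
      (add_nonneg hl0 hm0) (by ring)
    have hconv := hG.convexOn.2 (Ioo_subset_Icc_self hc₁) ha (sub_nonneg.2 hk1)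
      (add_nonneg hl0 hm0) (by ring)
    simp only [smul_eq_mul, ← hseq] at hconc hconv
    have hk : l + m = 1 := by
      by_contra hne
      have hk' : 0 < 1 - (l + m) := sub_pos.2 (lt_of_le_of_ne hk1 hne)
      rcases hfr with h | h | h | h
      · nlinarith [mul_pos hk' (sub_pos.2 hc₁.1)]
      · nlinarith [hc₁.2, mul_nonneg (add_nonneg hl0 hm0) (sub_nonneg.2 hc₁.1.le)]
      · nlinarith [mul_pos hk' (sub_pos.2 hc₂), mul_nonneg hl0 (sub_nonneg.2 h2),
          mul_nonneg hm0 (sub_nonneg.2 h2), mul_nonneg hl0 (sub_nonneg.2 hlt.le)]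
      · nlinarith [mul_pos hk' (sub_pos.2 hc₃), mul_nonneg hl0 (sub_nonneg.2 h1),
          mul_nonneg hm0 (sub_nonneg.2 h1), mul_nonneg hm0 (sub_nonneg.2 hlt.le)]
    rw [hk] at hseq hteq
    have hl' := mul_nonneg hl0 (sub_nonneg.2 hlt.le)
    have hm' := mul_nonneg hm0 (sub_nonneg.2 hlt.le)
    have hl1 : l = 1 - m := by linarith
    subst hl1
    exact ⟨by linarith, by linarith, by linarith⟩
  · rintro ⟨rfl, ht⟩
    have hfr : s • e + t • w ∈ frontier K :=
      (hG.mem_frontier_iff hK _ _).2 ⟨⟨ha, h2.trans ht.1, ht.2.trans h1⟩, by simp⟩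
    have hmid : (s + b) / 2 ∈ Ioo s b := ⟨by linarith [hG.lt], by linarith [hG.lt]⟩
    refine mem_bdArc_of_det2 hfr (hG.mid_mem_interior hmid) (fun h => ?_) ?_ ?_
    · exact hmid.1.ne (coord_inj hG.det_ne h).1
    · rcases ht.2.eq_or_lt with h | h
      · right; rw [h]
      · left
        rw [coord_sub, coord_sub, det2_coord]
        refine mul_pos hdet ?_
        nlinarith [mul_pos (sub_pos.2 hmid.1) (sub_pos.2 h)]
    · rcases ht.1.eq_or_lt with h | h
      · right; rw [h]
      · left
        rw [coord_sub, coord_sub, det2_coord]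
        refine mul_pos hdet ?_
        nlinarith [mul_pos (sub_pos.2 hmid.1) (sub_pos.2 h)]

/-- If the chord at `s₁` is not an edge, then the arc to its left contains a point with `s = a`, seen
from the midpoint of the chord. -/
lemma bdArc_ne_segment (hG : IsGraphBody K e w a b f g) (hK : IsClosed K) (hdet : 0 < det2 e w)
    {s₁ : ℝ} (hs₁ : s₁ ∈ Ioo a b) :
    bdArc K (s₁ • e + g s₁ • w) (s₁ • e + f s₁ • w) ≠
      segment ℝ (s₁ • e + g s₁ • w) (s₁ • e + f s₁ • w) := by
  intro h
  have ha := left_mem_Icc.2 hG.lt.le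
  have hlt := hG.lower_lt_upper s₁ hs₁
  have hmem : a • e + f a • w ∈ bdArc K (s₁ • e + g s₁ • w) (s₁ • e + f s₁ • w) := by
    refine mem_bdArc_of_det2 ((hG.mem_frontier_iff hK _ _).2 ⟨⟨ha, le_rfl, hG.le a ha⟩, by simp⟩)
      (hG.mid_mem_interior hs₁) (fun h => ?_) (Or.inl ?_) (Or.inl ?_)
    · have := (coord_inj hG.det_ne h).2
      linarith
    · rw [coord_sub, coord_sub, det2_coord]
      refine mul_pos hdet ?_
      nlinarith [mul_pos (sub_pos.2 hs₁.1) (sub_pos.2 hlt)]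
    · rw [coord_sub, coord_sub, det2_coord]
      refine mul_pos hdet ?_
      nlinarith [mul_pos (sub_pos.2 hs₁.1) (sub_pos.2 hlt)]
  rw [h, mem_segment_coord_iff hG.det_ne hlt.le] at hmem
  exact hs₁.1.ne hmem.1

end IsGraphBody

/-! ### Length of the boundary near the end of a chord -/

/-- On a short interval to the left of `s₁`, all increments of a concave function are close to those
of the linear function with slope the left derivative at `s₁`. -/
lemma ConcaveOn.eventually_abs_sub_le {g : ℝ → ℝ} {a b s₁ m η : ℝ}
    (hc : ConcaveOn ℝ (Icc a b) g) (hs₁ : s₁ ∈ Ioo a b)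
    (hm : HasDerivWithinAt g m (Iio s₁) s₁) (hη : 0 < η) :
    ∀ᶠ s in 𝓝[<] s₁, ∀ u v, s ≤ u → u ≤ v → v ≤ s₁ →
      |(g v - g u) - m * (v - u)| ≤ η * (v - u) := by
  have hlim := (hasDerivWithinAt_iff_tendsto_slope' self_notMem_Iio).1 hm
  obtain ⟨u₀, hu₀, hu₀I⟩ := ((hlim.eventually_lt_const (lt_add_of_pos_right m hη)).and
    (Ioo_mem_nhdsLT hs₁.1)).exists
  have hs₁c : s₁ ∈ Icc a b := Ioo_subset_Icc_self hs₁
  have hu₀c : u₀ ∈ Icc a b := ⟨hu₀I.1.le, (hu₀I.2.trans hs₁.2).le⟩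
  have hcont : Tendsto (fun s => slope g u₀ s) (𝓝[<] s₁) (𝓝 (slope g u₀ s₁)) := by
    have hg := hm.continuousWithinAt.tendsto
    have hid : Tendsto (fun s : ℝ => s - u₀) (𝓝[<] s₁) (𝓝 (s₁ - u₀)) :=
      (tendsto_id.sub_const u₀).mono_left nhdsWithin_le_nhds
    have := (hg.sub_const (g u₀)).div hid (sub_pos.2 hu₀I.2).ne'
    simp only [slope_def_field]
    exact this
  rw [slope_comm] at hu₀
  filter_upwards [hcont.eventually_lt_const hu₀, Ioo_mem_nhdsLT hu₀I.2] with s hs hsI u v hsu huv hv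
  rw [slope_def_field, div_lt_iff₀ (sub_pos.2 hsI.1)] at hs
  have hus₁ := huv.trans hv
  have hu₀u : u₀ < u := hsI.1.trans_le hsu
  have huc : u ∈ Icc a b := ⟨(hu₀I.1.trans hu₀u).le, hus₁.trans hs₁.2.le⟩
  have hvc : v ∈ Icc a b := ⟨huc.1.trans huv, hv.trans hs₁.2.le⟩
  rw [abs_le]
  constructor
  · rcases hus₁.eq_or_lt with h | h
    · have : v = u := le_antisymm (h ▸ hv) huv
      subst this; simp
    · have h1 := hc.three_point huc hs₁c huv hv
      have h2 := hc.le_slope_of_hasDerivWithinAt_Iio huc hs₁c h hm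
      rw [slope_def_field, le_div_iff₀ (sub_pos.2 h)] at h2
      have h3 : m * (v - u) * (s₁ - u) ≤ (g v - g u) * (s₁ - u) := by
        nlinarith [mul_le_mul_of_nonneg_right h2 (sub_nonneg.2 huv)]
      have h4 := le_of_mul_le_mul_right h3 (sub_pos.2 h)
      nlinarith [mul_nonneg hη.le (sub_nonneg.2 huv)]
  · have h1 := hc.three_point hu₀c huc hsI.1.le hsu
    have h2 := hc.three_point hu₀c hvc hu₀u.le huv
    have h3 : (g u - g u₀) * (s - u₀) ≤ (m + η) * (u - u₀) * (s - u₀) := by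
      nlinarith [mul_le_mul_of_nonneg_right hs.le (sub_pos.2 hu₀u).le]
    have h4 := le_of_mul_le_mul_right h3 (sub_pos.2 hsI.1)
    have h5 : (g v - g u) * (u - u₀) ≤ (m + η) * (v - u) * (u - u₀) := by
      nlinarith [mul_le_mul_of_nonneg_right h4 (sub_nonneg.2 huv)]
    linarith [le_of_mul_le_mul_right h5 (sub_pos.2 hu₀u)]

/-- The length of a graph over a short interval to the left of `s₁` is asymptotic to that of the
corresponding piece of its half-tangent. -/
lemma tendsto_arcLen_graph_div {p : Seminorm ℝ Plane} {e w : Plane} {φ : ℝ → ℝ} {s₁ m : ℝ}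
    (hφ : ∀ η > 0, ∀ᶠ s in 𝓝[<] s₁, ∀ u v, s ≤ u → u ≤ v → v ≤ s₁ →
      |(φ v - φ u) - m * (v - u)| ≤ η * (v - u)) :
    Tendsto (fun s => (arcLen p (fun u => u • e + φ u • w) (Icc s s₁)).toReal / (s₁ - s))
      (𝓝[<] s₁) (𝓝 (p (e + m • w))) := by
  rw [Metric.tendsto_nhds]
  intro ε hε
  have hpw : 0 ≤ p w := apply_nonneg p w
  set η := ε / (2 * (p w + 1)) with hη
  have hη0 : 0 < η := by positivity
  have hηε : η * p w < ε := by
    have : η * (2 * (p w + 1)) = ε := div_mul_cancel₀ _ (by positivity)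
    nlinarith
  filter_upwards [hφ η hη0, self_mem_nhdsWithin] with s hs hlt
  have hlt : s < s₁ := hlt
  have hpos : 0 < s₁ - s := sub_pos.2 hlt
  have hdec : ∀ u v : ℝ, (v • e + φ v • w) - (u • e + φ u • w) =
      (v - u) • (e + m • w) + ((φ v - φ u) - m * (v - u)) • w := fun u v => by module
  have hup : ∀ u v, s ≤ u → u ≤ v → v ≤ s₁ → p ((v • e + φ v • w) - (u • e + φ u • w)) ≤
      v * (p (e + m • w) + η * p w) - u * (p (e + m • w) + η * p w) := by
    intro u v h1 h2 h3
    rw [hdec]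
    refine (map_add_le_add p _ _).trans ?_
    rw [map_smul_eq_mul, map_smul_eq_mul, Real.norm_of_nonneg (sub_nonneg.2 h2), Real.norm_eq_abs]
    nlinarith [mul_le_mul_of_nonneg_right (hs u v h1 h2 h3) hpw]
  have hle := arcLen_le_of_le_sub (p := p) (γ := fun u => u • e + φ u • w)
    (F := fun u => u * (p (e + m • w) + η * p w)) hlt.le
    (fun u hu v hv huv => hup u v hu.1 huv hv.2)
  have hge := ofReal_le_arcLen (p := p) (fun u => u • e + φ u • w) (left_mem_Icc.2 hlt.le)
    (right_mem_Icc.2 hlt.le)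
  have hle' := ENNReal.toReal_mono ENNReal.ofReal_ne_top hle
  have hge' := ENNReal.toReal_mono (ne_top_of_le_ne_top ENNReal.ofReal_ne_top hle) hge
  have hpe : 0 ≤ p (e + m • w) := apply_nonneg p _
  rw [ENNReal.toReal_ofReal (by
    rw [← sub_mul]; exact mul_nonneg hpos.le (add_nonneg hpe (mul_nonneg hη0.le hpw)))] at hle'
  rw [ENNReal.toReal_ofReal (apply_nonneg p _)] at hge'
  have hlow : (s₁ - s) * (p (e + m • w) - η * p w) ≤
      p ((s₁ • e + φ s₁ • w) - (s • e + φ s • w)) := by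
    rw [hdec]
    have h1 := map_sub_le_add p ((s₁ - s) • (e + m • w) + ((φ s₁ - φ s) - m * (s₁ - s)) • w)
      (((φ s₁ - φ s) - m * (s₁ - s)) • w)
    rw [add_sub_cancel_right, map_smul_eq_mul, map_smul_eq_mul, Real.norm_of_nonneg hpos.le,
      Real.norm_eq_abs] at h1
    nlinarith [mul_le_mul_of_nonneg_right (hs s s₁ le_rfl hlt.le le_rfl) hpw]
  rw [Real.dist_eq]
  refine lt_of_le_of_lt ?_ hηε
  rw [abs_le]
  constructor
  · rw [le_sub_iff_add_le, le_div_iff₀ hpos]; nlinarith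
  · rw [sub_le_iff_le_add, div_le_iff₀ hpos]; nlinarith

/-! ### Left end of the set of long chords -/

/-- For a concave width function `h` on an interval with left end point `a` and a point `s₀` of it with
`h s₀ > t`, the point `α` is the left end of the interval of all `s` such that `t ≤ h s`. -/
structure IsLeftEnd (h : ℝ → ℝ) (a s₀ t α : ℝ) : Prop where
  left_le : a ≤ α
  lt : α < s₀
  le_width : t ≤ h α
  eq_or : α = a ∨ h α = t

namespace IsLeftEnd

variable {h : ℝ → ℝ} {a b s₀ t t' α α' : ℝ}

lemma exists_of_lt (hcont : ContinuousOn h (Icc a b)) (ha : a < s₀) (hb : s₀ ≤ b)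
    (ht : t < h s₀) : ∃ α, IsLeftEnd h a s₀ t α := by
  rcases le_or_gt t (h a) with h0 | h0
  · exact ⟨a, le_rfl, ha, h0, Or.inl rfl⟩
  · obtain ⟨α, hα, hαt⟩ := intermediate_value_Icc ha.le
      (hcont.mono (Icc_subset_Icc_right hb)) ⟨h0.le, ht.le⟩
    refine ⟨α, hα.1, lt_of_le_of_ne hα.2 ?_, hαt.ge, Or.inr hαt⟩
    rintro rfl
    exact ht.ne' hαt

lemma le_of_le_width (hα : IsLeftEnd h a s₀ t α) (hc : ConcaveOn ℝ (Icc a b) h) (hb : s₀ ≤ b)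
    (ht : t < h s₀) {s : ℝ} (hs : a ≤ s) (hts : t ≤ h s) : α ≤ s := by
  by_contra! hlt
  have hne : α ≠ a := (hs.trans_lt hlt).ne'
  have := hc.lt_of_between (u := s) (v := s₀) (s := α) ⟨hs, (hlt.trans hα.lt).le.trans hb⟩
    ⟨hα.left_le.trans hα.lt.le, hb⟩ hts ht (Or.inl ⟨hlt, hα.lt.le⟩)
  exact this.ne' (hα.eq_or.resolve_left hne)

lemma unique (hα : IsLeftEnd h a s₀ t α) (hα' : IsLeftEnd h a s₀ t α')
    (hc : ConcaveOn ℝ (Icc a b) h) (hb : s₀ ≤ b) (ht : t < h s₀) : α = α' :=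
  le_antisymm (hα.le_of_le_width hc hb ht hα'.left_le hα'.le_width)
    (hα'.le_of_le_width hc hb ht hα.left_le hα.le_width)

end IsLeftEnd

/-- The part of the perimeter of `K ∩ (K + t w)` that lies to the left of the chord at `s₀`, when the
body extends to the left down to `α t`: two graphs and an edge parallel to `w`. -/
noncomputable def leftLen (p : Seminorm ℝ Plane) (e w : Plane) (f g α : ℝ → ℝ) (s₀ t : ℝ) : ℝ :=
  (arcLen p (fun s => s • e + g s • w) (Icc (α t) s₀)).toReal +
    (arcLen p (fun s => s • e + f s • w) (Icc (α t) s₀)).toReal +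
    ((g - f) (α t) - t) * p w

namespace IsGraphBody

variable {K : Set Plane} {e w : Plane} {a b : ℝ} {f g : ℝ → ℝ}

lemma exists_leftDeriv_upper (hG : IsGraphBody K e w a b f g) {s₁ : ℝ} (hs₁ : s₁ ∈ Ioo a b) :
    ∃ m, HasDerivWithinAt g m (Iio s₁) s₁ := by
  have := hG.concaveOn.neg.hasDerivWithinAt_leftDeriv_of_mem_interior
    (x := s₁) (by rwa [interior_Icc])
  exact ⟨_, by simpa using this.neg⟩

lemma exists_leftDeriv_lower (hG : IsGraphBody K e w a b f g) {s₁ : ℝ} (hs₁ : s₁ ∈ Ioo a b) :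
    ∃ m, HasDerivWithinAt f m (Iio s₁) s₁ :=
  ⟨_, hG.convexOn.hasDerivWithinAt_leftDeriv_of_mem_interior (x := s₁) (by rwa [interior_Icc])⟩

/-- The two tangents at the ends of a chord are not parallel if some chord further to the right is
longer. -/
lemma leftDeriv_lt_leftDeriv (hG : IsGraphBody K e w a b f g) {s₁ s₀ mg mf : ℝ}
    (hs₁ : s₁ ∈ Ioo a b) (hs₀ : s₀ ∈ Icc a b) (hlt : s₁ < s₀)
    (hwidth : (g - f) s₁ < (g - f) s₀) (hmg : HasDerivWithinAt g mg (Iio s₁) s₁)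
    (hmf : HasDerivWithinAt f mf (Iio s₁) s₁) : mf < mg := by
  have hlim := (hasDerivWithinAt_iff_tendsto_slope' self_notMem_Iio).1 (hmg.sub hmf)
  have hκ : 0 < slope (g - f) s₁ s₀ := by
    rw [slope_def_field]; exact div_pos (sub_pos.2 hwidth) (sub_pos.2 hlt)
  have : slope (g - f) s₁ s₀ ≤ mg - mf := by
    refine ge_of_tendsto hlim ?_
    filter_upwards [Ioo_mem_nhdsLT hs₁.1] with s hs
    exact hG.concaveOn_width.slope_anti (Ioo_subset_Icc_self hs₁)
      ⟨⟨hs.1.le, (hs.2.trans hs₁.2).le⟩, hs.2.ne⟩ ⟨hs₀, hlt.ne'⟩ (hs.2.trans hlt).le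
  linarith

lemma arcLen_upper_add (hG : IsGraphBody K e w a b f g) (p : Seminorm ℝ Plane) {r s t : ℝ}
    (hr : a ≤ r) (hrs : r ≤ s) (hst : s ≤ t) (ht : t ≤ b) :
    (arcLen p (fun s => s • e + g s • w) (Icc r s)).toReal +
      (arcLen p (fun s => s • e + g s • w) (Icc s t)).toReal =
      (arcLen p (fun s => s • e + g s • w) (Icc r t)).toReal := by
  have hfin := hG.arcLen_upper_ne_top p
  rw [← arcLen_add p _ hrs hst, ENNReal.toReal_add]
  · exact ne_top_of_le_ne_top hfin (arcLen_mono p _ (Icc_subset_Icc hr (hst.trans ht)))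
  · exact ne_top_of_le_ne_top hfin (arcLen_mono p _ (Icc_subset_Icc (hr.trans hrs) ht))

lemma arcLen_lower_add (hG : IsGraphBody K e w a b f g) (p : Seminorm ℝ Plane) {r s t : ℝ}
    (hr : a ≤ r) (hrs : r ≤ s) (hst : s ≤ t) (ht : t ≤ b) :
    (arcLen p (fun s => s • e + f s • w) (Icc r s)).toReal +
      (arcLen p (fun s => s • e + f s • w) (Icc s t)).toReal =
      (arcLen p (fun s => s • e + f s • w) (Icc r t)).toReal := by
  simpa using hG.neg_snd.arcLen_upper_add p hr hrs hst ht

lemma tendsto_arcLen_upper_div (hG : IsGraphBody K e w a b f g) (p : Seminorm ℝ Plane) {s₁ m : ℝ}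
    (hs₁ : s₁ ∈ Ioo a b) (hm : HasDerivWithinAt g m (Iio s₁) s₁) :
    Tendsto (fun s => (arcLen p (fun u => u • e + g u • w) (Icc s s₁)).toReal / (s₁ - s))
      (𝓝[<] s₁) (𝓝 (p (e + m • w))) :=
  tendsto_arcLen_graph_div fun _ hη => hG.concaveOn.eventually_abs_sub_le hs₁ hm hη

lemma tendsto_arcLen_lower_div (hG : IsGraphBody K e w a b f g) (p : Seminorm ℝ Plane) {s₁ m : ℝ}
    (hs₁ : s₁ ∈ Ioo a b) (hm : HasDerivWithinAt f m (Iio s₁) s₁) :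
    Tendsto (fun s => (arcLen p (fun u => u • e + f u • w) (Icc s s₁)).toReal / (s₁ - s))
      (𝓝[<] s₁) (𝓝 (p (e + m • w))) := by
  simpa using hG.neg_snd.tendsto_arcLen_upper_div p hs₁ (m := -m) hm.neg

/-- If the chord of length `w` at the left is part of an edge, then decreasing `t` only lengthens that
edge. -/
lemma hasDerivWithinAt_leftLen_edge (hG : IsGraphBody K e w a b f g) (p : Seminorm ℝ Plane)
    {s₀ : ℝ} (hs₀ : s₀ ∈ Ioc a b) (hw : 1 < (g - f) s₀) {α : ℝ → ℝ}
    (hα : ∀ t ≤ 1, IsLeftEnd (g - f) a s₀ t (α t)) (ha : 1 ≤ (g - f) a) :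
    HasDerivWithinAt (leftLen p e w f g α s₀) (-p w) (Iic 1) 1 := by
  have hαa : ∀ t ≤ 1, α t = a := fun t ht =>
    (hα t ht).unique ⟨le_rfl, hs₀.1, ht.trans ha, Or.inl rfl⟩ hG.concaveOn_width hs₀.2
      (ht.trans_lt hw)
  have hd : HasDerivWithinAt (fun t : ℝ =>
      (arcLen p (fun s => s • e + g s • w) (Icc a s₀)).toReal +
      (arcLen p (fun s => s • e + f s • w) (Icc a s₀)).toReal +
      ((g - f) a - t) * p w) (-p w) (Iic 1) 1 := by
    have := (((hasDerivAt_id (1 : ℝ)).const_sub ((g - f) a)).mul_const (p w)).const_add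
      ((arcLen p (fun s => s • e + g s • w) (Icc a s₀)).toReal +
      (arcLen p (fun s => s • e + f s • w) (Icc a s₀)).toReal)
    simpa using this.hasDerivWithinAt
  refine hd.congr (fun t ht => ?_) ?_
  · rw [leftLen, hαa t ht]
  · rw [leftLen, hαa 1 le_rfl]

lemma tendsto_leftEnd (hG : IsGraphBody K e w a b f g)
    {s₀ : ℝ} (hs₀ : s₀ ∈ Ioc a b) (hw : 1 < (g - f) s₀) {α : ℝ → ℝ}
    (hα : ∀ t ≤ 1, IsLeftEnd (g - f) a s₀ t (α t)) {s₁ : ℝ} (has₁ : a < s₁)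
    (hs₁ : IsLeftEnd (g - f) a s₀ 1 s₁) : Tendsto α (𝓝[<] 1) (𝓝[<] s₁) := by
  have hconc := hG.concaveOn_width
  have h1 : (g - f) s₁ = 1 := hs₁.eq_or.resolve_left has₁.ne'
  have hlt : ∀ t < 1, α t < s₁ := by
    intro t ht
    have hle := (hα t ht.le).le_of_le_width hconc hs₀.2 (ht.trans hw) hs₁.left_le
      (ht.le.trans hs₁.le_width)
    refine lt_of_le_of_ne hle fun h => ?_
    have := (hα t ht.le).eq_or.resolve_left (h ▸ has₁.ne')
    rw [h, h1] at this
    exact ht.ne' this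
  refine tendsto_nhdsWithin_iff.2 ⟨tendsto_order.2 ⟨fun c hc => ?_, fun c hc => ?_⟩, ?_⟩
  · rcases lt_or_ge c a with hca | hca
    · filter_upwards [self_mem_nhdsWithin] with t ht
      exact hca.trans_le (hα t (le_of_lt ht)).left_le
    · have hc1 : (g - f) c < 1 := by
        by_contra! hge
        exact absurd (hs₁.le_of_le_width hconc hs₀.2 hw hca hge) (not_le.2 hc)
      filter_upwards [Ioo_mem_nhdsLT hc1] with t ht
      by_contra! hle
      have hl := hα t ht.2.le
      rcases hle.eq_or_lt with h | h
      · exact absurd (h ▸ hl.le_width) (not_le.2 ht.1)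
      · have := hconc.lt_of_between (u := α t) (v := s₀) (s := c)
          ⟨hl.left_le, hl.lt.le.trans hs₀.2⟩ ⟨hs₀.1.le, hs₀.2⟩ hl.le_width (ht.2.trans hw)
          (Or.inl ⟨h, (hc.trans hs₁.lt).le⟩)
        exact absurd this (not_lt.2 ht.1.le)
  · filter_upwards [self_mem_nhdsWithin] with t ht
    exact (hlt t ht).trans hc
  · filter_upwards [self_mem_nhdsWithin] with t ht
    exact hlt t ht

/-- If the left chord of length `w` joins the two graphs, then decreasing `t` by `δ` moves that chord
to the left by about `δ / (mg - mf)`, and the boundary gains two short arcs with the directions of the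
left half-tangents. -/
lemma hasDerivWithinAt_leftLen (hG : IsGraphBody K e w a b f g) (p : Seminorm ℝ Plane)
    {s₀ : ℝ} (hs₀ : s₀ ∈ Ioc a b) (hw : 1 < (g - f) s₀) {α : ℝ → ℝ}
    (hα : ∀ t ≤ 1, IsLeftEnd (g - f) a s₀ t (α t)) {s₁ mg mf : ℝ} (has₁ : a < s₁)
    (hs₁ : IsLeftEnd (g - f) a s₀ 1 s₁) (hmg : HasDerivWithinAt g mg (Iio s₁) s₁)
    (hmf : HasDerivWithinAt f mf (Iio s₁) s₁) :
    HasDerivWithinAt (leftLen p e w f g α s₀)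
      (-((p (e + mg • w) + p (e + mf • w)) / (mg - mf))) (Iic 1) 1 := by
  have hconc := hG.concaveOn_width
  have h1 : (g - f) s₁ = 1 := hs₁.eq_or.resolve_left has₁.ne'
  have hs₁I : s₁ ∈ Ioo a b := ⟨has₁, hs₁.lt.trans_le hs₀.2⟩
  have hm : mf < mg := hG.leftDeriv_lt_leftDeriv hs₁I ⟨hs₀.1.le, hs₀.2⟩ hs₁.lt (h1.trans_lt hw)
    hmg hmf
  have hα1 : α 1 = s₁ := (hα 1 le_rfl).unique hs₁ hconc hs₀.2 hw
  have hT := hG.tendsto_leftEnd hs₀ hw hα has₁ hs₁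
  rw [← hasDerivWithinAt_Iio_iff_Iic, hasDerivWithinAt_iff_tendsto_slope' self_notMem_Iio]
  have hlim := ((((hG.tendsto_arcLen_upper_div p hs₁I hmg).add
    (hG.tendsto_arcLen_lower_div p hs₁I hmf)).div
    ((hasDerivWithinAt_iff_tendsto_slope' self_notMem_Iio).1 (hmg.sub hmf))
    (sub_pos.2 hm).ne').neg).comp hT
  refine hlim.congr' ?_
  have hT' := tendsto_nhdsWithin_iff.1 hT
  filter_upwards [self_mem_nhdsWithin, hT'.2, hT'.1.eventually_const_lt has₁] with t ht hαt haα
  have ht : t < 1 := ht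
  have hαt : α t < s₁ := hαt
  have hαw : (g - f) (α t) = t := (hα t ht.le).eq_or.resolve_left haα.ne'
  have hpos : 0 < s₁ - α t := sub_pos.2 hαt
  have e1 := hG.arcLen_upper_add p (hα t ht.le).left_le hαt.le hs₁.lt.le hs₀.2
  have e2 := hG.arcLen_lower_add p (hα t ht.le).left_le hαt.le hs₁.lt.le hs₀.2
  simp only [Function.comp_apply, Pi.div_apply, slope_def_field]
  rw [leftLen, leftLen, hα1, hαw, h1, ← e1, ← e2, sub_self, sub_self, zero_mul]
  have hne : t - 1 ≠ 0 := (sub_neg.2 ht).ne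
  have hne' : α t - s₁ ≠ 0 := (sub_neg.2 hαt).ne
  rw [← neg_sub (α t) s₁]
  field_simp
  ring

end IsGraphBody

/-! ### Caps over chords -/

namespace IsGraphBody

variable {K : Set Plane} {e w : Plane} {a b : ℝ} {f g : ℝ → ℝ}

/-- A translate of `[o, w]` with end points on the boundary, other than on the edge `s = b`, either
lies on the edge `s = a` or joins the two graphs. -/
lemma chord_cases (hG : IsGraphBody K e w a b f g) (hK : IsClosed K) {s₁ y₁ : ℝ} (hs₁ : s₁ < b)
    (h1 : s₁ • e + y₁ • w ∈ frontier K) (h2 : s₁ • e + (y₁ - 1) • w ∈ frontier K) :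
    (s₁ = a ∧ f a ≤ y₁ - 1 ∧ y₁ ≤ g a) ∨ (s₁ ∈ Ioo a b ∧ y₁ = g s₁ ∧ y₁ - 1 = f s₁) := by
  rw [hG.mem_frontier_iff hK] at h1 h2
  obtain ⟨⟨hs, hy1, hy2⟩, h1⟩ := h1
  obtain ⟨⟨-, hy3, hy4⟩, h2⟩ := h2
  rcases hs.1.eq_or_lt with rfl | h
  · exact Or.inl ⟨rfl, hy3, hy2⟩
  · refine Or.inr ⟨⟨h, hs₁⟩, ?_, ?_⟩
    · rcases h1 with h1 | h1 | h1 | h1 <;> linarith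
    · rcases h2 with h2 | h2 | h2 | h2 <;> linarith

lemma isLeftEnd_of_chord (hG : IsGraphBody K e w a b f g) (hK : IsClosed K) {s₀ s₁ y₁ : ℝ}
    (hs₀ : s₀ ≤ b) (hlt : s₁ < s₀) (h1 : s₁ • e + y₁ • w ∈ frontier K)
    (h2 : s₁ • e + (y₁ - 1) • w ∈ frontier K) : IsLeftEnd (g - f) a s₀ 1 s₁ := by
  rcases hG.chord_cases hK (hlt.trans_le hs₀) h1 h2 with ⟨rfl, h3, h4⟩ | ⟨h, h3, h4⟩
  · exact ⟨le_rfl, hlt, by simp only [Pi.sub_apply]; linarith, Or.inl rfl⟩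
  · exact ⟨h.1.le, hlt, by simp only [Pi.sub_apply]; linarith,
      Or.inr (by simp only [Pi.sub_apply]; linarith)⟩

lemma exists_chord (hG : IsGraphBody K e w a b f g) (hK : IsClosed K) {s₀ : ℝ}
    (hs₀ : s₀ ∈ Ioc a b) (hw : 1 < (g - f) s₀) : ∃ s₁ y₁ : ℝ, s₁ < s₀ ∧
      s₁ • e + y₁ • w ∈ frontier K ∧ s₁ • e + (y₁ - 1) • w ∈ frontier K := by
  obtain ⟨s₁, h⟩ := IsLeftEnd.exists_of_lt hG.continuousOn_width hs₀.1 hs₀.2 hw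
  have hs₁ : s₁ ∈ Icc a b := ⟨h.left_le, h.lt.le.trans hs₀.2⟩
  have h1 := h.le_width
  simp only [Pi.sub_apply] at h1
  refine ⟨s₁, f s₁ + 1, h.lt, (hG.mem_frontier_iff hK _ _).2 ⟨⟨hs₁, by linarith, by linarith⟩, ?_⟩,
    (hG.mem_frontier_iff hK _ _).2 ⟨⟨hs₁, by linarith, by linarith⟩, by simp⟩⟩
  rcases h.eq_or with h2 | h2
  · exact Or.inl h2
  · simp only [Pi.sub_apply] at h2
    exact Or.inr (Or.inr (Or.inr (by linarith)))

lemma exists_isCapApex (hG : IsGraphBody K e w a b f g) (hK : IsClosed K) (hdet : 0 < det2 e w)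
    {s₀ s₁ y₁ : ℝ} (hs₀ : s₀ ∈ Icc a b) (hw : 1 < (g - f) s₀) (hlt : s₁ < s₀)
    (h1 : s₁ • e + y₁ • w ∈ frontier K) (h2 : s₁ • e + (y₁ - 1) • w ∈ frontier K) :
    ∃ q, IsCapApex K (s₁ • e + y₁ • w) (s₁ • e + (y₁ - 1) • w) q := by
  rcases hG.chord_cases hK (hlt.trans_le hs₀.2) h1 h2 with ⟨rfl, h3, h4⟩ | ⟨hs₁, h3, h4⟩
  · exact ⟨_, Or.inl ⟨hG.bdArc_eq_segment hK hdet (by linarith) h4 h3, left_mem_segment ℝ _ _⟩⟩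
  · obtain ⟨mg, hmg⟩ := hG.exists_leftDeriv_upper hs₁
    obtain ⟨mf, hmf⟩ := hG.exists_leftDeriv_lower hs₁
    have hm := hG.leftDeriv_lt_leftDeriv hs₁ hs₀ hlt
      (by refine lt_of_eq_of_lt ?_ hw; simp only [Pi.sub_apply]; linarith) hmg hmf
    have hr : (mg - mf)⁻¹ * (mg - mf) = 1 := inv_mul_cancel₀ (sub_pos.2 hm).ne'
    rw [h4, h3]
    refine ⟨(s₁ • e + g s₁ • w) - (mg - mf)⁻¹ • (e + mg • w),
      Or.inr ⟨hG.bdArc_ne_segment hK hdet hs₁, ?_, ?_⟩⟩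
    · rw [hG.mem_rightTangent_iff hK hdet hs₁ hmg]
      exact ⟨_, rfl⟩
    · rw [hG.mem_leftTangent_iff hK hdet hs₁ hmf]
      refine ⟨(mg - mf)⁻¹, ?_⟩
      have hg : g s₁ = f s₁ + (mg - mf)⁻¹ * (mg - mf) := by linarith
      rw [hg]
      module

/-- The left part of the perimeter of `K ∩ (K + t w)` decreases in `t` at the rate given by the length
of the cap over the left chord. -/
theorem hasDerivWithinAt_leftLen_cap (hG : IsGraphBody K e w a b f g) (hK : IsClosed K)
    (hdet : 0 < det2 e w) {B : Set Plane} {p : Seminorm ℝ Plane} (hp : Continuous p)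
    (hpB : ∀ v, p v = gauge B v) {s₀ s₁ y₁ : ℝ} (hs₀ : s₀ ∈ Ioc a b) (hw : 1 < (g - f) s₀)
    (hlt : s₁ < s₀) (h1 : s₁ • e + y₁ • w ∈ frontier K)
    (h2 : s₁ • e + (y₁ - 1) • w ∈ frontier K) {α : ℝ → ℝ}
    (hα : ∀ t ≤ 1, IsLeftEnd (g - f) a s₀ t (α t)) {q : Plane}
    (hq : IsCapApex K (s₁ • e + y₁ • w) (s₁ • e + (y₁ - 1) • w) q) :
    HasDerivWithinAt (leftLen p e w f g α s₀)
      (-lenB B (capSet (s₁ • e + y₁ • w) q (s₁ • e + (y₁ - 1) • w))) (Iic 1) 1 := by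
  have hend := hG.isLeftEnd_of_chord hK hs₀.2 hlt h1 h2
  rcases hG.chord_cases hK (hlt.trans_le hs₀.2) h1 h2 with ⟨rfl, h3, h4⟩ | ⟨hs₁, h3, h4⟩
  · have hseg := hG.bdArc_eq_segment hK hdet (y₁ := y₁) (y₂ := y₁ - 1) (by linarith) h4 h3
    have hqs := (hq.resolve_right fun h => h.1 hseg).2
    have hne : s₁ • e + y₁ • w ≠ s₁ • e + (y₁ - 1) • w := fun h => by
      have := (coord_inj hG.det_ne h).2
      linarith
    have hcap : capSet (s₁ • e + y₁ • w) q (s₁ • e + (y₁ - 1) • w) =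
        segment ℝ (s₁ • e + y₁ • w) (s₁ • e + (y₁ - 1) • w) := by
      refine Subset.antisymm (union_subset ?_ ?_) fun z hz => ?_
      · exact (convex_segment _ _).segment_subset (left_mem_segment ℝ _ _) hqs
      · exact (convex_segment _ _).segment_subset hqs (right_mem_segment ℝ _ _)
      · obtain ⟨s, y, rfl⟩ := exists_coord hG.det_ne z
        obtain ⟨s', y', rfl⟩ := exists_coord hG.det_ne q
        have hle : y₁ - 1 ≤ y₁ := by linarith
        rw [mem_segment_coord_iff hG.det_ne hle] at hz hqs
        obtain ⟨rfl, hy⟩ := hz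
        obtain ⟨rfl, hy'⟩ := hqs
        rcases le_total y' y with h | h
        · left
          rw [mem_segment_coord_iff hG.det_ne hy'.2]
          exact ⟨rfl, h, hy.2⟩
        · right
          rw [mem_segment_coord_iff hG.det_ne hy'.1]
          exact ⟨rfl, hy.1, h⟩
    rw [hcap, lenB_segment hp hpB hne,
      show s₁ • e + (y₁ - 1) • w - (s₁ • e + y₁ • w) = -w by module, map_neg_eq_map]
    exact hG.hasDerivWithinAt_leftLen_edge p hs₀ hw hα
      (by simp only [Pi.sub_apply]; linarith)
  · obtain ⟨mg, hmg⟩ := hG.exists_leftDeriv_upper hs₁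
    obtain ⟨mf, hmf⟩ := hG.exists_leftDeriv_lower hs₁
    rw [h4, h3] at hq ⊢
    obtain ⟨-, hq1, hq2⟩ := hq.resolve_left fun h => hG.bdArc_ne_segment hK hdet hs₁ h.1
    obtain ⟨r, hr⟩ := (hG.mem_rightTangent_iff hK hdet hs₁ hmg q).1 hq1
    obtain ⟨r', hr'⟩ := (hG.mem_leftTangent_iff hK hdet hs₁ hmf q).1 hq2
    -- comparing coordinates determines the apex: `r = r' = (mg - mf)⁻¹`
    have hcoord := hr.symm.trans hr'
    rw [show s₁ • e + g s₁ • w - r • (e + mg • w) = (s₁ - r) • e + (g s₁ - r * mg) • w by module,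
      show s₁ • e + f s₁ • w - r' • (e + mf • w) = (s₁ - r') • e + (f s₁ - r' * mf) • w by module]
      at hcoord
    obtain ⟨e1, e2⟩ := coord_inj hG.det_ne hcoord
    obtain rfl : r = r' := by linarith
    have hrm : r * (mg - mf) = 1 := by linarith
    have hm := hG.leftDeriv_lt_leftDeriv hs₁ ⟨hs₀.1.le, hs₀.2⟩ hlt
      (by refine lt_of_eq_of_lt ?_ hw; simp only [Pi.sub_apply]; linarith) hmg hmf
    have hr0 : 0 < r := pos_of_mul_pos_left (hrm.symm ▸ one_pos) (sub_pos.2 hm).le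
    have hA : q - (s₁ • e + g s₁ • w) = (-r) • (e + mg • w) := by rw [hr]; module
    have hC : (s₁ • e + f s₁ • w) - q = r • (e + mf • w) := by rw [hr']; module
    have hdetAC : det2 (q - (s₁ • e + g s₁ • w)) ((s₁ • e + f s₁ • w) - q) ≠ 0 := by
      rw [hA, hC, det2_smul_left, det2_smul_right]
      have := det2_coord e w 1 mg 1 mf
      rw [one_smul] at this
      rw [this]
      refine mul_ne_zero (neg_ne_zero.2 hr0.ne') (mul_ne_zero hr0.ne' (mul_ne_zero hdet.ne' ?_))
      linarith
    rw [lenB_capSet hp hpB hdetAC, hA, hC, map_smul_eq_mul, map_smul_eq_mul, norm_neg,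
      Real.norm_of_nonneg hr0.le, ← mul_add]
    have := hG.hasDerivWithinAt_leftLen p hs₀ hw hα hs₁.1 hend hmg hmf
    rwa [div_eq_of_eq_mul (sub_pos.2 hm).ne' (c := r * (p (e + mg • w) + p (e + mf • w)))
      (by linear_combination (-(p (e + mg • w) + p (e + mf • w))) * hrm)] at this

/-! ### The perimeter of the intersection of a body with its translate -/

/-- `K ∩ (K + t w)` is the body between the graphs of `f + t` and `g`, over the interval of those `s`
at which the chord of `K` parallel to `w` has length at least `t`. -/
lemma inter_translate (hG : IsGraphBody K e w a b f g) (hcomp : IsCompact K) (hconv : Convex ℝ K)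
    {s₀ t α β : ℝ} (hs₀ : s₀ ∈ Ioo a b) (ht0 : 0 ≤ t) (ht : t < (g - f) s₀)
    (hα : IsLeftEnd (g - f) a s₀ t α)
    (hβ : IsLeftEnd (fun s => (g - f) (-s)) (-b) (-s₀) t (-β)) :
    IsCompact (K ∩ (fun y => y + t • w) '' K) ∧ Convex ℝ (K ∩ (fun y => y + t • w) '' K) ∧
      IsGraphBody (K ∩ (fun y => y + t • w) '' K) e w α β (fun s => f s + t) g := by
  have hc := hcomp.inter (hcomp.image (continuous_add_const (t • w)))
  have hv : Convex ℝ (K ∩ (fun y => y + t • w) '' K) := by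
    refine hconv.inter ?_
    have := hconv.translate (t • w)
    simpa only [add_comm] using this
  have hαs₀ := hα.lt
  have hβs₀ : s₀ < β := neg_lt_neg_iff.1 hβ.lt
  have hβb : β ≤ b := neg_le_neg_iff.1 hβ.left_le
  have hsub : Icc α β ⊆ Icc a b := Icc_subset_Icc hα.left_le hβb
  have hgw := hG.concaveOn_width
  have hβw : t ≤ (g - f) β := by simpa using hβ.le_width
  have hwidth : ∀ s ∈ Icc a b, t ≤ (g - f) s ↔ s ∈ Icc α β := by
    intro s hs
    constructor
    · intro h
      refine ⟨hα.le_of_le_width hgw hs₀.2.le ht hs.1 h, ?_⟩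
      by_contra! hlt
      have h1 : (g - f) β = t := by
        have := hβ.eq_or.resolve_left fun h => (hlt.trans_le hs.2).ne (neg_injective h)
        simpa using this
      have := hgw.lt_of_between hs (Ioo_subset_Icc_self hs₀) h ht (Or.inr ⟨hβs₀.le, hlt⟩)
      exact this.ne' h1
    · rintro ⟨h1, h2⟩
      have hαI : α ∈ Icc a b := ⟨hα.left_le, hαs₀.le.trans hs₀.2.le⟩
      have hβI : β ∈ Icc a b := ⟨hs₀.1.le.trans hβs₀.le, hβb⟩
      exact (le_min hα.le_width hβw).trans (hgw.ge_on_segment hαI hβI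
        (by rw [segment_eq_Icc (h1.trans h2)]; exact ⟨h1, h2⟩))
  refine ⟨hc, hv, IsGraphBody.of_mem_iff hc hv hG.det_ne (fun s y => ?_) (fun s hs => ?_)
    (hαs₀.trans hβs₀) ⟨hαs₀.le, hβs₀.le⟩ ?_⟩
  · have himg : s • e + y • w ∈ (fun y => y + t • w) '' K ↔ s • e + (y - t) • w ∈ K := by
      constructor
      · rintro ⟨v, hv, hveq⟩
        have : v = s • e + (y - t) • w := by
          rw [eq_sub_of_add_eq hveq]; module
        rwa [← this]
      · intro h
        exact ⟨_, h, by module⟩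
    rw [mem_inter_iff, himg, hG.mem_iff, hG.mem_iff]
    constructor
    · rintro ⟨⟨hs, -, h1⟩, -, h2, -⟩
      exact ⟨(hwidth s hs).1 (by simp only [Pi.sub_apply]; linarith), by linarith, h1⟩
    · rintro ⟨hs, h1, h2⟩
      exact ⟨⟨hsub hs, by linarith, h2⟩, hsub hs, by linarith, by linarith⟩
  · have := (hwidth s (hsub hs)).2 hs
    simp only [Pi.sub_apply] at this
    linarith
  · simp only [Pi.sub_apply] at ht
    linarith

/-- The perimeter of `K ∩ (K + t w)` is the sum of the parts on the two sides of the chord at `s₀`; the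
right part is the left part in the basis rotated by `π`. -/
theorem perCovariogram_eq (hG : IsGraphBody K e w a b f g) (hcomp : IsCompact K)
    (hconv : Convex ℝ K) {B : Set Plane} {p : Seminorm ℝ Plane} (hp : Continuous p)
    (hpB : ∀ v, p v = gauge B v) {s₀ t : ℝ} {α α' : ℝ → ℝ} (hs₀ : s₀ ∈ Ioo a b) (ht0 : 0 ≤ t)
    (ht : t < (g - f) s₀) (hα : IsLeftEnd (g - f) a s₀ t (α t))
    (hα' : IsLeftEnd (fun s => (g - f) (-s)) (-b) (-s₀) t (α' t)) :
    perCovariogram B K (t • w) = leftLen p e w f g α s₀ t +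
      leftLen p (-e) (-w) (fun s => -g (-s)) (fun s => -f (-s)) α' (-s₀) t := by
  obtain ⟨β, hβ⟩ : ∃ β, α' t = -β := ⟨-α' t, (neg_neg _).symm⟩
  rw [hβ] at hα'
  obtain ⟨hc, hv, hL⟩ := hG.inter_translate hcomp hconv hs₀ ht0 ht hα hα'
  have hαs₀ := hα.lt.le
  have hβs₀ : s₀ ≤ β := (neg_lt_neg_iff.1 hα'.lt).le
  have hβb : β ≤ b := neg_le_neg_iff.1 hα'.left_le
  rw [perCovariogram, hL.perB_eq hc hv hp hpB,
    arcLen_congr_sub (γ := fun s => s • e + (f s + t) • w) (γ' := fun s => s • e + f s • w)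
      (fun s _ t' _ => by module),
    ← hG.arcLen_upper_add p hα.left_le hαs₀ hβs₀ hβb,
    ← hG.arcLen_lower_add p hα.left_le hαs₀ hβs₀ hβb, leftLen, leftLen, hβ]
  have hup : arcLen p (fun s => s • (-e) + (-g (-s)) • (-w)) (Icc (-β) (-s₀)) =
      arcLen p (fun s => s • e + g s • w) (Icc s₀ β) := by
    rw [← arcLen_comp_neg]
    simp only [neg_neg, smul_neg, neg_smul]
  have hlow : arcLen p (fun s => s • (-e) + (-f (-s)) • (-w)) (Icc (-β) (-s₀)) =
      arcLen p (fun s => s • e + f s • w) (Icc s₀ β) := by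
    rw [← arcLen_comp_neg]
    simp only [neg_neg, smul_neg, neg_smul]
  rw [hup, hlow, map_neg_eq_map]
  simp only [Pi.sub_apply, neg_neg]
  ring

end IsGraphBody

/-! ### Inscribed parallelograms -/

namespace IsGraphBody

variable {K : Set Plane} {e w : Plane} {a b : ℝ} {f g : ℝ → ℝ}

lemma exists_one_lt_width (hG : IsGraphBody K e w a b f g) (hw : w ∈ interior (K - K)) :
    ∃ s ∈ Icc a b, 1 < (g - f) s := by
  obtain ⟨ε, hε, h, -⟩ := exists_pos_add_mem_of_mem_interior hw w
  obtain ⟨u, hu, v, hv, huv⟩ := h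
  obtain ⟨s, y, rfl⟩ := exists_coord hG.det_ne u
  obtain ⟨s', y', rfl⟩ := exists_coord hG.det_ne v
  have huv' : (s - s') • e + (y - y') • w = (0 : ℝ) • e + (1 + ε) • w := by
    rw [← coord_sub]
    refine huv.trans ?_
    module
  obtain ⟨h1, h2⟩ := coord_inj hG.det_ne huv'
  obtain rfl : s = s' := sub_eq_zero.1 h1
  obtain ⟨hs, -, hy⟩ := (hG.mem_iff _ _).1 hu
  obtain ⟨-, hy', -⟩ := (hG.mem_iff _ _).1 hv
  exact ⟨s, hs, by simp only [Pi.sub_apply]; linarith⟩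

lemma exists_one_lt_width_Ioo (hG : IsGraphBody K e w a b f g) (hw : w ∈ interior (K - K)) :
    ∃ s ∈ Ioo a b, 1 < (g - f) s := by
  obtain ⟨s, hs, h⟩ := hG.exists_one_lt_width hw
  have hbot : (𝓝[Ioo a b] s).NeBot := by
    rwa [← mem_closure_iff_nhdsWithin_neBot, closure_Ioo hG.lt.ne]
  have := ((hG.continuousOn_width s hs).mono Ioo_subset_Icc_self).tendsto.eventually_const_lt h
  obtain ⟨s', h1, h2⟩ := (this.and self_mem_nhdsWithin).exists
  exact ⟨s', h2, h1⟩

/-- Coordinates of the edge `[p₂, p₁]` of an inscribed parallelogram. -/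
lemma exists_coord_edge (hG : IsGraphBody K e w a b f g) {p₁ p₂ : Plane} (h : w = p₁ - p₂) :
    ∃ s y : ℝ, p₁ = s • e + y • w ∧ p₂ = s • e + (y - 1) • w := by
  obtain ⟨s, y, rfl⟩ := exists_coord hG.det_ne p₁
  refine ⟨s, y, rfl, ?_⟩
  rw [eq_sub_iff_add_eq', ← eq_sub_iff_add_eq] at h
  rw [h]
  module

/-- The two edges of an inscribed parallelogram lie at different values of the first coordinate, and
between them there is a chord longer than `w`. -/
lemma exists_between (hG : IsGraphBody K e w a b f g) (hK : IsClosed K) (hdet : 0 < det2 e w)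
    (hw : w ∈ interior (K - K)) {s₁ y₁ s₃ y₃ : ℝ}
    (hpar : IsInscribedParallelogram K w (s₁ • e + y₁ • w) (s₁ • e + (y₁ - 1) • w)
      (s₃ • e + (y₃ - 1) • w) (s₃ • e + y₃ • w)) :
    ∃ s₀ ∈ Ioo a b, s₁ < s₀ ∧ s₀ < s₃ ∧ 1 < (g - f) s₀ := by
  have hlt : s₁ < s₃ := by
    have := hpar.ccw
    rw [coord_sub, coord_sub, det2_coord] at this
    have := pos_of_mul_pos_right this hdet.le
    nlinarith
  obtain ⟨h1, -⟩ := (hG.mem_frontier_iff hK _ _).1 hpar.mem₁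
  obtain ⟨h2, -⟩ := (hG.mem_frontier_iff hK _ _).1 hpar.mem₂
  obtain ⟨h3, -⟩ := (hG.mem_frontier_iff hK _ _).1 hpar.mem₃
  obtain ⟨h4, -⟩ := (hG.mem_frontier_iff hK _ _).1 hpar.mem₄
  have hw1 : 1 ≤ (g - f) s₁ := by simp only [Pi.sub_apply]; linarith
  have hw3 : 1 ≤ (g - f) s₃ := by simp only [Pi.sub_apply]; linarith
  obtain ⟨s, hs, hsw⟩ := hG.exists_one_lt_width hw
  have hconc := hG.concaveOn_width
  have hm1 : s₁ < (s₁ + s₃) / 2 := by linarith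
  have hm3 : (s₁ + s₃) / 2 < s₃ := by linarith
  refine ⟨(s₁ + s₃) / 2, ⟨h1.1.1.trans_lt hm1, hm3.trans_le h3.1.2⟩, hm1, hm3, ?_⟩
  rcases le_total s ((s₁ + s₃) / 2) with h | h
  · exact hconc.lt_of_between h3.1 hs hw3 hsw (Or.inr ⟨h, hm3⟩)
  · exact hconc.lt_of_between h1.1 hs hw1 hsw (Or.inl ⟨hm1, h⟩)

end IsGraphBody

lemma exists_det2_pos {x : Plane} (hx : x ≠ 0) : ∃ e : Plane, 0 < det2 e x := by
  refine ⟨!₂[x 1, -x 0], ?_⟩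
  have : x 0 ≠ 0 ∨ x 1 ≠ 0 := by
    by_contra! h
    apply hx
    ext i
    fin_cases i
    exacts [h.1, h.2]
  simp only [det2, Fin.isValue, Matrix.cons_val_zero, Matrix.cons_val_one,
    Matrix.cons_val_fin_one]
  rcases this with h | h
  · nlinarith [mul_self_pos.2 h, mul_self_nonneg (x 1)]
  · nlinarith [mul_self_pos.2 h, mul_self_nonneg (x 0)]

/-! ### The left derivative of the perimeter-covariogram -/

theorem theorem4p2 (B K : Set Plane) (hB : IsSeminormBall B) (hK : IsPlanarBody K)
    (x : Plane) (hx : x ∈ interior (K - K)) (hx0 : x ≠ 0) :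
    (∃ p₁ p₂ p₃ p₄ p₁₂ p₃₄ : Plane, IsInscribedParallelogram K x p₁ p₂ p₃ p₄ ∧
      IsCapApex K p₁ p₂ p₁₂ ∧ IsCapApex K p₃ p₄ p₃₄) ∧
    ∀ p₁ p₂ p₃ p₄ p₁₂ p₃₄ : Plane, IsInscribedParallelogram K x p₁ p₂ p₃ p₄ →
      IsCapApex K p₁ p₂ p₁₂ → IsCapApex K p₃ p₄ p₃₄ →
      HasDerivWithinAt (fun t : ℝ => perCovariogram B K (t • x))
        (-(lenB B (capSet p₁ p₁₂ p₂) + lenB B (capSet p₃ p₃₄ p₄))) (Iic 1) 1 := by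
  obtain ⟨p, hp, hpB⟩ := hB.exists_seminorm
  obtain ⟨e, hdet⟩ := exists_det2_pos hx0
  have hdet' : 0 < det2 (-e) (-x) := by rwa [det2_neg_left, det2_neg_right, neg_neg]
  obtain ⟨a, b, f, g, hG⟩ := hK.exists_isGraphBody hdet.ne'
  have hG' := hG.neg_basis
  have hcl := hK.isCompact.isClosed
  have hwidth' : ∀ s, ((fun s => -f (-s)) - fun s => -g (-s)) s = (g - f) (-s) := fun s => by
    simp only [Pi.sub_apply]; ring
  constructor
  · obtain ⟨s₀, hs₀, hw⟩ := hG.exists_one_lt_width_Ioo hx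
    have hs₀' : -s₀ ∈ Ioo (-b) (-a) := ⟨neg_lt_neg hs₀.2, neg_lt_neg hs₀.1⟩
    have hw' : 1 < ((fun s => -f (-s)) - fun s => -g (-s)) (-s₀) := by rwa [hwidth', neg_neg]
    obtain ⟨s₁, y₁, hlt, h1, h2⟩ := hG.exists_chord hcl ⟨hs₀.1, hs₀.2.le⟩ hw
    obtain ⟨s₃, y₃, hlt', h3, h4⟩ := hG'.exists_chord hcl ⟨hs₀'.1, hs₀'.2.le⟩ hw'
    obtain ⟨q, hq⟩ := hG.exists_isCapApex hcl hdet (Ioo_subset_Icc_self hs₀) hw hlt h1 h2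
    obtain ⟨q', hq'⟩ := hG'.exists_isCapApex hcl hdet' (Ioo_subset_Icc_self hs₀') hw' hlt' h3 h4
    refine ⟨_, _, _, _, q, q', ⟨h1, h2, h3, h4, by module, by module, ?_⟩, hq, hq'⟩
    rw [show s₃ • (-e) + y₃ • (-x) = (-s₃) • e + (-y₃) • x by module, coord_sub, coord_sub,
      det2_coord]
    refine mul_pos hdet ?_
    linarith
  · intro p₁ p₂ p₃ p₄ q q' hpar hq hq'
    obtain ⟨s₁, y₁, rfl, rfl⟩ := hG.exists_coord_edge hpar.eq₁₂
    obtain ⟨s₃, y₃, rfl, rfl⟩ := hG.exists_coord_edge hpar.eq₄₃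
    obtain ⟨s₀, hs₀, hlt1, hlt3, hw⟩ := hG.exists_between hcl hdet hx hpar
    have hs₀' : -s₀ ∈ Ioo (-b) (-a) := ⟨neg_lt_neg hs₀.2, neg_lt_neg hs₀.1⟩
    have hw' : 1 < ((fun s => -f (-s)) - fun s => -g (-s)) (-s₀) := by rwa [hwidth', neg_neg]
    have hex : ∀ t : ℝ, ∃ α, t ≤ 1 → IsLeftEnd (g - f) a s₀ t α := fun t => by
      by_cases ht : t ≤ 1
      · obtain ⟨α, hα⟩ := IsLeftEnd.exists_of_lt hG.continuousOn_width hs₀.1 hs₀.2.le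
          (ht.trans_lt hw)
        exact ⟨α, fun _ => hα⟩
      · exact ⟨0, fun h => absurd h ht⟩
    have hex' : ∀ t : ℝ, ∃ α, t ≤ 1 →
        IsLeftEnd ((fun s => -f (-s)) - fun s => -g (-s)) (-b) (-s₀) t α := fun t => by
      by_cases ht : t ≤ 1
      · obtain ⟨α, hα⟩ := IsLeftEnd.exists_of_lt hG'.continuousOn_width hs₀'.1 hs₀'.2.le
          (ht.trans_lt hw')
        exact ⟨α, fun _ => hα⟩
      · exact ⟨0, fun h => absurd h ht⟩
    choose α hα using hex
    choose α' hα' using hex'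
    have e3 : s₃ • e + (y₃ - 1) • x = (-s₃) • (-e) + (1 - y₃) • (-x) := by module
    have e4 : s₃ • e + y₃ • x = (-s₃) • (-e) + (1 - y₃ - 1) • (-x) := by module
    have hm3 := hpar.mem₃
    have hm4 := hpar.mem₄
    rw [e3] at hm3
    rw [e4] at hm4
    rw [e3, e4] at hq'
    have hleft := hG.hasDerivWithinAt_leftLen_cap hcl hdet hp hpB ⟨hs₀.1, hs₀.2.le⟩ hw hlt1
      hpar.mem₁ hpar.mem₂ hα hq
    have hright := hG'.hasDerivWithinAt_leftLen_cap hcl hdet' hp hpB ⟨hs₀'.1, hs₀'.2.le⟩ hw'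
      (neg_lt_neg hlt3) hm3 hm4 hα' hq'
    rw [e3, e4, neg_add]
    have heq : ∀ t : ℝ, 0 ≤ t → t ≤ 1 → perCovariogram B K (t • x) = leftLen p e x f g α s₀ t +
        leftLen p (-e) (-x) (fun s => -g (-s)) (fun s => -f (-s)) α' (-s₀) t := fun t ht0 ht1 => by
      have h' := hα' t ht1
      rw [show ((fun s => -f (-s)) - fun s => -g (-s)) = fun s => (g - f) (-s) from
        funext hwidth'] at h'
      exact hG.perCovariogram_eq hK.isCompact hK.convex hp hpB hs₀ ht0 (ht1.trans_lt hw)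
        (hα t ht1) h'
    refine (hleft.add hright).congr_of_eventuallyEq ?_ (heq 1 zero_le_one le_rfl)
    filter_upwards [self_mem_nhdsWithin, nhdsWithin_le_nhds (Ioi_mem_nhds one_pos)] with t ht1 ht0
    exact heq t (le_of_lt ht0) ht1
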